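/- A \emph{labeled graph} is a finite set $V$ with a symmetric set of edges $D\subseteq V^2$ and a labeling $L:V\to\mathbb{R}^n$; $\mathrm{Neigh}(v)=\{v' : (v,v')\in D\}$, and the degree of the graph is $\max_v|\mathrm{Neigh}(v)|$. A \emph{ReLU network} is a composition of finitely many (at least one) layers $x\mapsto\sigma(Wx+b)$ with rational $W,b$ and matching dimensions, where in each layer $\sigma$ is either the componentwise $\max(0,\cdot)$ or the identity (so networks with ReLU in all layers, and those with a linear output layer, are included). A \emph{node-classifier MPNN} $N$ consists of finitely many ReLU networks $N_1,\dots,N_k$ and a readout ReLU network $N_r$ of matching dimensions; on a labeled graph with a node $v$ it computes $x^0_u=L(u)$, $x^i_u=N_i\bigl(x^{i-1}_u,\sum_{u'\in\mathrm{Neigh}(u)}x^{i-1}_{u'}\bigr)$ for all nodes $u$, and outputs $N(\mathcal G,v)=N_r(x^k_v)$. A \emph{vector specification} $\psi$ is a finite conjunction of linear inequalities $\sum_i c_i x_i\le b$ with rational $c_i,b$. A \emph{bounded graph-node specification} $\varphi$ consists of $d,k\in\mathbb{N}$ and vector specifications $\psi_0,\dots,\psi_k$; a graph $\mathcal G$ with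 centre $v$ satisfies $\varphi$ iff $\mathcal G$ has degree at most $d$ and, for each $i\le k$, the label of every node at distance $i$ from $v$ satisfies $\psi_i$ (for $\psi_0=\dots=\psi_k=\psi$: all nodes in the $k$-neighbourhood of $v$ satisfy $\psi$). \textbf{Theorem.} Output reachability of node-classifier MPNNs over inputs of bounded degree is decidable: there is an algorithm which, given a node-classifier MPNN $N$, a bounded graph-node specification $\varphi$ (including $d$ and $k$) on its inputs and a vector specification $\psi$ on its outputs, always terminates and answers correctly whether there are a labeled graph $\mathcal G$ and a node $v$ such that $(\mathcal G,v)$ satisfies $\varphi$ and $N(\mathcal G,v)$ satisfies $\psi$. -/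

import Mathlib

/-!
Node-classifier message passing neural networks, linear specifications, output reachability
properties, and formal verifiability (existence of a total computable decision function on a
finite encoding of the instances).
-/

namespace GNN

/-! ### Feed-forward ReLU networks with rational parameters -/

/-- One layer of a feed-forward network from dimension `m` to dimension `n`, computing
`x ↦ W x + b`, followed by the componentwise ReLU if `relu = true`. A network all of whose layers
have `relu = true` uses ReLU everywhere; a network whose last layer has `relu = false` has a linear
output layer. -/
structure NNLayer (m n : ℕ) where
  weight : Matrix (Fin n) (Fin m) ℚ
  bias : Fin n → ℚ
  relu : Bool

/-- The function computed by a layer. -/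
noncomputable def NNLayer.eval {m n : ℕ} (l : NNLayer m n) (x : Fin m → ℝ) : Fin n → ℝ :=
  fun i =>
    let y : ℝ := ∑ j, (l.weight i j : ℝ) * x j + (l.bias i : ℝ)
    if l.relu = true then max 0 y else y

/-- Feed-forward neural networks: nonempty sequences of layers with matching dimensions. -/
inductive NN : ℕ → ℕ → Type
  | single {m n : ℕ} (l : NNLayer m n) : NN m n
  | cons {m p n : ℕ} (l : NNLayer m p) (N : NN p n) : NN m n

/-- The function computed by a network. -/
noncomputable def NN.eval : {m n : ℕ} → NN m n → (Fin m → ℝ) → (Fin n → ℝ)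
  | _, _, .single l, x => l.eval x
  | _, _, .cons l N, x => N.eval (l.eval x)

/-! ### Labeled graphs -/

/-- Finite undirected graphs (the edge set is a symmetric set of pairs of nodes) with node labels
in `ℝ ^ n`. -/
structure LGraph (n : ℕ) where
  V : Type
  [fintypeV : Fintype V]
  Adj : V → V → Prop
  symm : ∀ u v, Adj u v → Adj v u
  label : V → Fin n → ℝ

attribute [instance] LGraph.fintypeV

open Classical in
/-- The neighbourhood of a node. -/
noncomputable def LGraph.neigh {n : ℕ} (G : LGraph n) (v : G.V) : Finset G.V :=
  Finset.univ.filter (fun u => G.Adj v u)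

/-- The degree of the graph is at most `d`. -/
def LGraph.DegreeLE {n : ℕ} (G : LGraph n) (d : ℕ) : Prop :=
  ∀ v : G.V, (G.neigh v).card ≤ d

/-- The set of nodes at distance at most `k` from `v`. -/
def LGraph.ball {n : ℕ} (G : LGraph n) (v : G.V) : ℕ → Set G.V
  | 0 => {v}
  | k + 1 => {u | u ∈ G.ball v k ∨ ∃ w ∈ G.ball v k, G.Adj w u}

/-- The node `u` has distance exactly `k` from `v`. -/
def LGraph.AtDist {n : ℕ} (G : LGraph n) (v u : G.V) (k : ℕ) : Prop :=
  u ∈ G.ball v k ∧ ∀ j < k, u ∉ G.ball v j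

/-! ### Node-classifier MPNN -/

/-- Node-classifier MPNN with label dimension `m` and output dimension `n`: a finite sequence of
message passing layers, each given by a network combining the vector of a node with the
(equidimensional) aggregate of its neighbours, followed by a readout network. -/
inductive MPNN : ℕ → ℕ → Type
  | readout {m n : ℕ} (N : NN m n) : MPNN m n
  | layer {m p n : ℕ} (N : NN (m + m) p) (rest : MPNN p n) : MPNN m n

/-- The new vector of each node after a message passing layer whose combination is given by `N`:
the aggregation is the sum over the neighbours. -/
noncomputable def LGraph.step {k m p : ℕ} (G : LGraph k) (N : NN (m + m) p)
    (x : G.V → Fin m → ℝ) : G.V → Fin p → ℝ :=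
  fun v => N.eval (Fin.append (x v) (∑ u ∈ G.neigh v, x u))

/-- Run an MPNN on the graph structure `G` with current node vectors `x`. -/
noncomputable def MPNN.run {k : ℕ} (G : LGraph k) :
    {m n : ℕ} → MPNN m n → (G.V → Fin m → ℝ) → G.V → Fin n → ℝ
  | _, _, .readout N, x => fun v => N.eval (x v)
  | _, _, .layer N rest, x => rest.run G (G.step N x)

/-- The application of a node-classifier MPNN to a graph and a node. -/
noncomputable def MPNN.eval {m n : ℕ} (N : MPNN m n) (G : LGraph m) (v : G.V) : Fin n → ℝ :=
  N.run G G.label v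

/-! ### Specifications -/

/-- A linear inequality `∑ i, coeff i * x i ≤ bound` with rational coefficients. -/
structure LinIneq (n : ℕ) where
  coeff : Fin n → ℚ
  bound : ℚ

/-- Satisfaction of a linear inequality by a real vector. -/
def LinIneq.Sat {n : ℕ} (c : LinIneq n) (x : Fin n → ℝ) : Prop :=
  ∑ i, (c.coeff i : ℝ) * x i ≤ (c.bound : ℝ)

/-- Vector specifications: finite conjunctions of linear inequalities. -/
abbrev VecSpec (n : ℕ) := List (LinIneq n)

/-- Satisfaction of a vector specification. -/
def VecSpec.Sat {n : ℕ} (ψ : VecSpec n) (x : Fin n → ℝ) : Prop :=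
  ∀ c ∈ ψ, c.Sat x

/-- Graph-node specifications that bound the degree by `deg` and constrain the labels of the nodes
at distance at most `radius` from the centre by vector specifications: the nodes at distance `i`
have to satisfy `constr i`. With a constant `constr` all nodes in the `radius`-neighbourhood are
constrained by the same vector specification. -/
structure BoundSpec (n : ℕ) where
  deg : ℕ
  radius : ℕ
  constr : Fin (radius + 1) → VecSpec n

/-- Satisfaction of a graph-node specification. -/
def BoundSpec.Sat {n : ℕ} (φ : BoundSpec n) (G : LGraph n) (v : G.V) : Prop :=
  G.DegreeLE φ.deg ∧
    ∀ (i : Fin (φ.radius + 1)) (u : G.V), G.AtDist v u i → (φ.constr i).Sat (G.label u)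

/-! ### Output reachability properties -/

/-- Output reachability properties of node-classifier MPNN, with degree-bounding graph-node
specifications as input specifications and vector specifications as output specifications. -/
structure NodeORP where
  inDim : ℕ
  outDim : ℕ
  net : MPNN inDim outDim
  input : BoundSpec inDim
  output : VecSpec outDim

/-- The property holds iff some valid input is mapped to a valid output. -/
def NodeORP.Holds (P : NodeORP) : Prop :=
  ∃ (G : LGraph P.inDim) (v : G.V), P.input.Sat G v ∧ P.output.Sat (P.net.eval G v)

/-! ### Encoding of the instances as finite data -/

/-- Rational numbers are written as numerator and denominator. -/
abbrev RatCode := ℤ × ℕ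

/-- The code of a rational number. -/
def ratCode (q : ℚ) : RatCode := (q.num, q.den)

/-- Vectors are written as lists of their entries. -/
def vecCode {n : ℕ} (x : Fin n → ℚ) : List RatCode := List.ofFn fun i => ratCode (x i)

/-- Input dimension, output dimension, rows of the weight matrix, bias, activation. -/
abbrev LayerCode := (ℕ × ℕ) × List (List RatCode) × List RatCode × Bool

/-- The code of a layer. -/
def NNLayer.code {m n : ℕ} (l : NNLayer m n) : LayerCode :=
  ((m, n), (List.ofFn fun i => vecCode (l.weight i)), vecCode l.bias, l.relu)

/-- A network is written as the list of its layers. -/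
def NN.code : {m n : ℕ} → NN m n → List LayerCode
  | _, _, .single l => [l.code]
  | _, _, .cons l N => l.code :: N.code

/-- An MPNN is written as the list of its combination networks, followed by its readout network. -/
def MPNN.code : {m n : ℕ} → MPNN m n → List (List LayerCode)
  | _, _, .readout N => [N.code]
  | _, _, .layer N rest => N.code :: rest.code

/-- A vector specification is written as the list of its inequalities. -/
abbrev VecSpecCode := List (List RatCode × RatCode)

/-- The code of a vector specification. -/
def VecSpec.code {n : ℕ} (ψ : VecSpec n) : VecSpecCode :=
  ψ.map fun c => (vecCode c.coeff, ratCode c.bound)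

/-- Degree bound, radius, list of label constraints. -/
abbrev BoundSpecCode := ℕ × ℕ × List VecSpecCode

/-- The code of a graph-node specification. -/
def BoundSpec.code {n : ℕ} (φ : BoundSpec n) : BoundSpecCode :=
  (φ.deg, φ.radius, List.ofFn fun i => (φ.constr i).code)

/-- Dimensions, MPNN, input specification, output specification. -/
abbrev NodeORPCode := (ℕ × ℕ) × List (List LayerCode) × BoundSpecCode × VecSpecCode

/-- The code of an output reachability property. -/
def NodeORP.code (P : NodeORP) : NodeORPCode :=
  ((P.inDim, P.outDim), P.net.code, P.input.code, P.output.code)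

/-! ### Formal verifiability -/

/-- A class of properties, given to algorithms through the encoding `code`, is formally verifiable
if there is an algorithm (a total computable function) that answers `true` on a property of the
class exactly if the property holds. -/
def FormallyVerifiable {Q C : Type} [Primcodable C] (code : Q → C) (Holds : Q → Prop) : Prop :=
  ∃ A : C → Bool, Computable A ∧ ∀ P : Q, A (code P) = true ↔ Holds P

end GNN

/-! The output of an MPNN at `v` depends only on the ball around `v` whose radius is the number `L`
of its networks (`IsBallEmbedding.run_eq`). In degree at most `d` this ball has at most `(d + 1) ^
L` nodes, and passing to the induced subgraph keeps the degree bound and the distances from `v`. So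
a reachable output is reached on a graph of bounded size (`NodeORP.Holds.exists_finGraph`), and only
finitely many graphs matter.

For a fixed graph the labels still range over real vectors. Once the phase of every ReLU unit
(active or inactive) is fixed as well, the layer equations, the sign conditions on the
pre-activations and both specifications form one rational linear system in the entries of all node
vectors (`realSat_iff`). A graph together with distances and phases is a "shape"; shapes are coded
by the numbers below a computable bound.

By Farkas' lemma such a system has a rational solution or a rational certificate of contradiction
(`exists_check`), and a certificate excludes real solutions too. A simultaneous search for either
therefore terminates and decides solvability over the reals (`feasible_iff`). Checking a candidate
is primitive recursive, hence the search is computable, and the decision procedure runs it on every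
shape. Its correctness is `holds_of_realSat` together with `exists_realSat_of_holds`. -/

namespace GNN

/-! ### Primitive recursive functions: closure properties in applied form -/

-- With the closure properties in applied form, primitive recursiveness of each later check follows
-- by unfolding it and calling `fun_prop`.
attribute [fun_prop] Primrec

section Closure

variable {α β γ σ : Type*} [Primcodable α] [Primcodable β] [Primcodable γ] [Primcodable σ]

@[fun_prop] theorem primrec_id : Primrec (fun a : α => a) := Primrec.id

@[fun_prop] theorem primrec_const (b : β) : Primrec (fun _ : α => b) := Primrec.const b

@[fun_prop] theorem primrec_comp {f : β → γ} {g : α → β} (hf : Primrec f) (hg : Primrec g) :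
    Primrec (fun a => f (g a)) := hf.comp hg

@[fun_prop] theorem primrec_fst {f : α → β × γ} (hf : Primrec f) : Primrec (fun a => (f a).1) :=
  Primrec.fst.comp hf

@[fun_prop] theorem primrec_snd {f : α → β × γ} (hf : Primrec f) : Primrec (fun a => (f a).2) :=
  Primrec.snd.comp hf

@[fun_prop] theorem primrec_mk {f : α → β} {g : α → γ} (hf : Primrec f) (hg : Primrec g) :
    Primrec (fun a => (f a, g a)) := hf.pair hg

@[fun_prop] theorem primrec_add {f g : α → ℕ} (hf : Primrec f) (hg : Primrec g) :
    Primrec (fun a => f a + g a) := Primrec.nat_add.comp hf hg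

@[fun_prop] theorem primrec_sub {f g : α → ℕ} (hf : Primrec f) (hg : Primrec g) :
    Primrec (fun a => f a - g a) := Primrec.nat_sub.comp hf hg

@[fun_prop] theorem primrec_mul {f g : α → ℕ} (hf : Primrec f) (hg : Primrec g) :
    Primrec (fun a => f a * g a) := Primrec.nat_mul.comp hf hg

@[fun_prop] theorem primrec_div {f g : α → ℕ} (hf : Primrec f) (hg : Primrec g) :
    Primrec (fun a => f a / g a) := Primrec.nat_div.comp hf hg

@[fun_prop] theorem primrec_mod {f g : α → ℕ} (hf : Primrec f) (hg : Primrec g) :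
    Primrec (fun a => f a % g a) := Primrec.nat_mod.comp hf hg

@[fun_prop] theorem primrec_pow {f g : α → ℕ} (hf : Primrec f) (hg : Primrec g) :
    Primrec (fun a => f a ^ g a) :=
  (Primrec₂.unpaired'.1 Nat.Primrec.pow).comp hf hg

@[fun_prop] theorem primrec_natPair {f g : α → ℕ} (hf : Primrec f) (hg : Primrec g) :
    Primrec (fun a => Nat.pair (f a) (g a)) := Primrec₂.natPair.comp hf hg

@[fun_prop] theorem primrec_and {f g : α → Bool} (hf : Primrec f) (hg : Primrec g) :
    Primrec (fun a => f a && g a) := Primrec.and.comp hf hg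

@[fun_prop] theorem primrec_or {f g : α → Bool} (hf : Primrec f) (hg : Primrec g) :
    Primrec (fun a => f a || g a) := Primrec.or.comp hf hg

@[fun_prop] theorem primrec_not {f : α → Bool} (hf : Primrec f) :
    Primrec (fun a => !(f a)) := Primrec.not.comp hf

@[fun_prop] theorem primrec_cond {c : α → Bool} {f g : α → σ} (hc : Primrec c) (hf : Primrec f)
    (hg : Primrec g) : Primrec (fun a => bif c a then f a else g a) := Primrec.cond hc hf hg

@[fun_prop] theorem primrec_nat_beq {f g : α → ℕ} (hf : Primrec f) (hg : Primrec g) :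
    Primrec (fun a => f a == g a) := Primrec.beq.comp hf hg

@[fun_prop] theorem primrec_decide_le {f g : α → ℕ} (hf : Primrec f) (hg : Primrec g) :
    Primrec (fun a => decide (f a ≤ g a)) := Primrec.nat_le.decide.comp hf hg

@[fun_prop] theorem primrec_decide_lt {f g : α → ℕ} (hf : Primrec f) (hg : Primrec g) :
    Primrec (fun a => decide (f a < g a)) := Primrec.nat_lt.decide.comp hf hg

@[fun_prop] theorem primrec_getD {f : α → List σ} {g : α → ℕ} (d : σ) (hf : Primrec f)
    (hg : Primrec g) : Primrec (fun a => (f a).getD (g a) d) :=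
  (Primrec.list_getD d).comp hf hg

@[fun_prop] theorem primrec_length {f : α → List σ} (hf : Primrec f) :
    Primrec (fun a => (f a).length) := Primrec.list_length.comp hf

end Closure

/-- Iteration of an operation over an initial segment of the natural numbers. -/
def natFold {σ : Type*} (z : σ) (op : σ → σ → σ) (n : ℕ) (f : ℕ → σ) : σ :=
  Nat.rec z (fun i s => op s (f i)) n

theorem primrec_natFold {α σ : Type*} [Primcodable α] [Primcodable σ] (z : σ) {op : σ → σ → σ}
    (hop : Primrec₂ op) {n : α → ℕ} {f : α → ℕ → σ} (hn : Primrec n)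
    (hf : Primrec fun p : α × ℕ => f p.1 p.2) : Primrec fun a => natFold z op (n a) (f a) :=
  Primrec.nat_rec' hn (Primrec.const z) (h := fun a p => op p.2 (f a p.1))
    (hop.comp (by fun_prop) (by fun_prop))

/-- Bounded universal quantification. -/
def allLT (n : ℕ) (f : ℕ → Bool) : Bool := natFold true (· && ·) n f

/-- Bounded existential quantification. -/
def anyLT (n : ℕ) (f : ℕ → Bool) : Bool := natFold false (· || ·) n f

/-- Bounded summation. -/
def sumLT (n : ℕ) (f : ℕ → ℕ) : ℕ := natFold 0 (· + ·) n f

theorem allLT_iff {n : ℕ} {f : ℕ → Bool} : allLT n f = true ↔ ∀ i < n, f i = true := by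
  induction n with
  | zero => simp [allLT, natFold]
  | succ n ih =>
    have : allLT (n + 1) f = (allLT n f && f n) := rfl
    rw [this, Bool.and_eq_true, ih, Nat.forall_lt_succ_right]

theorem anyLT_iff {n : ℕ} {f : ℕ → Bool} : anyLT n f = true ↔ ∃ i < n, f i = true := by
  induction n with
  | zero => simp [anyLT, natFold]
  | succ n ih =>
    have : anyLT (n + 1) f = (anyLT n f || f n) := rfl
    rw [this, Bool.or_eq_true, ih, Nat.exists_lt_succ_right]

theorem sumLT_eq (n : ℕ) (f : ℕ → ℕ) : sumLT n f = ∑ i ∈ Finset.range n, f i := by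
  induction n with
  | zero => rfl
  | succ n ih =>
    have : sumLT (n + 1) f = sumLT n f + f n := rfl
    rw [this, ih, Finset.sum_range_succ]

section Bounded

variable {α : Type*} [Primcodable α] {n : α → ℕ}

@[fun_prop] theorem primrec_allLT {f : α → ℕ → Bool} (hn : Primrec n)
    (hf : Primrec fun p : α × ℕ => f p.1 p.2) : Primrec fun a => allLT (n a) (f a) :=
  primrec_natFold _ Primrec.and hn hf

@[fun_prop] theorem primrec_anyLT {f : α → ℕ → Bool} (hn : Primrec n)
    (hf : Primrec fun p : α × ℕ => f p.1 p.2) : Primrec fun a => anyLT (n a) (f a) :=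
  primrec_natFold _ Primrec.or hn hf

@[fun_prop] theorem primrec_sumLT {f : α → ℕ → ℕ} (hn : Primrec n)
    (hf : Primrec fun p : α × ℕ => f p.1 p.2) : Primrec fun a => sumLT (n a) (f a) :=
  primrec_natFold _ Primrec.nat_add hn hf

end Bounded

/-! ### Rational numbers as triples of natural numbers -/

/-- The triple `(p, n, d)` stands for the rational number `(p - n) / (d + 1)`. -/
abbrev Fr := ℕ × ℕ × ℕ

namespace Fr

/-- The rational number written by a triple. -/
def val (a : Fr) : ℚ := ((a.1 : ℚ) - a.2.1) / (a.2.2 + 1)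

def zero : Fr := (0, 0, 0)

def one : Fr := (1, 0, 0)

/-- Denominators are stored minus one, so the product of the denominators `a + 1` and `b + 1` is
stored as `a * b + a + b`. Fractions are never reduced. -/
def add (a b : Fr) : Fr :=
  (a.1 * (b.2.2 + 1) + b.1 * (a.2.2 + 1), a.2.1 * (b.2.2 + 1) + b.2.1 * (a.2.2 + 1),
    a.2.2 * b.2.2 + a.2.2 + b.2.2)

def neg (a : Fr) : Fr := (a.2.1, a.1, a.2.2)

def mul (a b : Fr) : Fr :=
  (a.1 * b.1 + a.2.1 * b.2.1, a.1 * b.2.1 + a.2.1 * b.1, a.2.2 * b.2.2 + a.2.2 + b.2.2)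

/-- Cross-multiplication, with the negative parts moved to the other side so that only natural
numbers are compared. -/
def le (a b : Fr) : Bool :=
  decide (a.1 * (b.2.2 + 1) + b.2.1 * (a.2.2 + 1) ≤ b.1 * (a.2.2 + 1) + a.2.1 * (b.2.2 + 1))

/-- Bounded summation. -/
def sum (n : ℕ) (f : ℕ → Fr) : Fr := natFold zero add n f

/-- The triple for a rational number given by numerator and denominator. -/
def ofCode (q : RatCode) : Fr :=
  ((Equiv.intEquivNat q.1 + 1) / 2 * ((Equiv.intEquivNat q.1 + 1) % 2),
    (Equiv.intEquivNat q.1 + 1) / 2 * (Equiv.intEquivNat q.1 % 2), q.2 - 1)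

theorem val_zero : val zero = 0 := by simp [val, zero]

theorem val_one : val one = 1 := by simp [val, one]

theorem val_add (a b : Fr) : val (add a b) = val a + val b := by
  have h1 : (a.2.2 : ℚ) + 1 ≠ 0 := by positivity
  have h2 : (b.2.2 : ℚ) + 1 ≠ 0 := by positivity
  have h3 : (a.2.2 : ℚ) * b.2.2 + a.2.2 + b.2.2 + 1 = (a.2.2 + 1) * (b.2.2 + 1) := by ring
  simp only [val, add]
  push_cast
  rw [h3]
  field_simp
  ring

theorem val_neg (a : Fr) : val (neg a) = -val a := by
  simp only [val, neg]
  ring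

theorem val_mul (a b : Fr) : val (mul a b) = val a * val b := by
  have h1 : (a.2.2 : ℚ) + 1 ≠ 0 := by positivity
  have h2 : (b.2.2 : ℚ) + 1 ≠ 0 := by positivity
  have h3 : (a.2.2 : ℚ) * b.2.2 + a.2.2 + b.2.2 + 1 = (a.2.2 + 1) * (b.2.2 + 1) := by ring
  simp only [val, mul]
  push_cast
  rw [h3]
  field_simp
  ring

theorem le_iff (a b : Fr) : le a b = true ↔ val a ≤ val b := by
  have h1 : (0 : ℚ) < (a.2.2 : ℚ) + 1 := by positivity
  have h2 : (0 : ℚ) < (b.2.2 : ℚ) + 1 := by positivity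
  simp only [val, le, decide_eq_true_eq]
  rw [div_le_div_iff₀ h1 h2, ← Nat.cast_le (α := ℚ)]
  push_cast
  constructor <;> intro h <;> linarith

theorem val_sum (n : ℕ) (f : ℕ → Fr) : val (sum n f) = ∑ i ∈ Finset.range n, val (f i) := by
  induction n with
  | zero => exact val_zero
  | succ n ih =>
    have : sum (n + 1) f = add (sum n f) (f n) := rfl
    rw [this, val_add, ih, Finset.sum_range_succ]

theorem val_ofCode (q : ℚ) : val (ofCode (ratCode q)) = q := by
  have hd : ((q.den - 1 : ℕ) : ℚ) + 1 = q.den := by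
    exact_mod_cast congrArg (Nat.cast (R := ℚ)) (Nat.sub_add_cancel q.den_pos)
  -- The code of `n` is `2 * n` and that of `-(n + 1)` is `2 * n + 1`. Thus half of the successor of
  -- the code is the absolute value, and the parity of the code is the sign.
  have hn : ∀ z : ℤ, (((Equiv.intEquivNat z + 1) / 2 * ((Equiv.intEquivNat z + 1) % 2) : ℕ) : ℚ) -
      (((Equiv.intEquivNat z + 1) / 2 * (Equiv.intEquivNat z % 2) : ℕ) : ℚ) = z := by
    intro z
    cases z with
    | ofNat n =>
      have h : Equiv.intEquivNat (Int.ofNat n) = 2 * n := rfl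
      have h1 : (2 * n + 1) / 2 = n := by omega
      have h2 : (2 * n + 1) % 2 = 1 := by omega
      have h3 : (2 * n) % 2 = 0 := by omega
      rw [h, h1, h2, h3]
      simp
    | negSucc n =>
      have h : Equiv.intEquivNat (Int.negSucc n) = 2 * n + 1 := rfl
      have h1 : (2 * n + 1 + 1) / 2 = n + 1 := by omega
      have h2 : (2 * n + 1 + 1) % 2 = 0 := by omega
      have h3 : (2 * n + 1) % 2 = 1 := by omega
      rw [h, h1, h2, h3]
      simp [Int.cast_negSucc]
  simp only [val, ofCode, ratCode]
  rw [hd, hn, Rat.num_div_den]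

theorem exists_val (q : ℚ) : ∃ a, val a = q := ⟨_, val_ofCode q⟩

section

variable {α : Type*} [Primcodable α]

@[fun_prop] theorem primrec_add {f g : α → Fr} (hf : Primrec f) (hg : Primrec g) :
    Primrec fun a => add (f a) (g a) := by unfold add; fun_prop

@[fun_prop] theorem primrec_neg {f : α → Fr} (hf : Primrec f) :
    Primrec fun a => neg (f a) := by unfold neg; fun_prop

@[fun_prop] theorem primrec_mul {f g : α → Fr} (hf : Primrec f) (hg : Primrec g) :
    Primrec fun a => mul (f a) (g a) := by unfold mul; fun_prop

@[fun_prop] theorem primrec_le {f g : α → Fr} (hf : Primrec f) (hg : Primrec g) :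
    Primrec fun a => le (f a) (g a) := by unfold le; fun_prop

@[fun_prop] theorem primrec_sum {n : α → ℕ} {f : α → ℕ → Fr} (hn : Primrec n)
    (hf : Primrec fun p : α × ℕ => f p.1 p.2) : Primrec fun a => sum (n a) (f a) :=
  primrec_natFold _ (primrec_add Primrec.fst Primrec.snd) hn hf

-- This bijection is the encoding of `ℤ` itself, which is why `ofCode` is written with it.
@[fun_prop] theorem primrec_intEquivNat {f : α → ℤ} (hf : Primrec f) :
    Primrec fun a => Equiv.intEquivNat (f a) := Primrec.encode.comp hf

@[fun_prop] theorem primrec_ofCode {f : α → RatCode} (hf : Primrec f) :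
    Primrec fun a => ofCode (f a) := by unfold ofCode; fun_prop

end

end Fr

end GNN

/-! ### Theorem of the alternative for rational linear systems. -/

namespace GNN

/-! ### Farkas' lemma over the rational numbers -/

/-- Finitely many linear inequalities in one variable are solvable if the pairs of an upper and a
lower bound are compatible. -/
theorem exists_forall_mul_le {ι : Type} [Fintype ι] (a r : ι → ℚ)
    (h0 : ∀ i, a i = 0 → 0 ≤ r i)
    (h1 : ∀ p q, 0 < a p → a q < 0 → 0 ≤ -a q * r p + a p * r q) :
    ∃ x : ℚ, ∀ i, a i * x ≤ r i := by
  classical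
  by_cases hq : ∃ q, a q < 0
  · obtain ⟨q₀, hq₀⟩ := hq
    -- The greatest lower bound is a solution. Without lower bounds the least upper bound is one,
    -- and without either the value `0`.
    obtain ⟨q, hqm, hmax⟩ := Finset.exists_max_image (Finset.univ.filter fun q => a q < 0)
      (fun q => r q / a q) ⟨q₀, by simpa using hq₀⟩
    have hqn : a q < 0 := by simpa using hqm
    refine ⟨r q / a q, fun i => ?_⟩
    rcases lt_trichotomy (a i) 0 with hi | hi | hi
    · have := hmax i (by simpa using hi)
      calc a i * (r q / a q) ≤ a i * (r i / a i) := mul_le_mul_of_nonpos_left this hi.le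
        _ = r i := mul_div_cancel₀ _ hi.ne
    · simpa [hi] using h0 i hi
    · have := h1 i q hi hqn
      rw [← mul_div_assoc, div_le_iff_of_neg hqn]
      linarith
  · push Not at hq
    by_cases hp : ∃ p, 0 < a p
    · obtain ⟨p₀, hp₀⟩ := hp
      obtain ⟨p, hpm, hmin⟩ := Finset.exists_min_image (Finset.univ.filter fun p => 0 < a p)
        (fun p => r p / a p) ⟨p₀, by simpa using hp₀⟩
      refine ⟨r p / a p, fun i => ?_⟩
      rcases (hq i).eq_or_lt with hi | hi
      · simpa [← hi] using h0 i hi.symm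
      · have := hmin i (by simpa using hi)
        calc a i * (r p / a p) ≤ a i * (r i / a i) := mul_le_mul_of_nonneg_left this hi.le
          _ = r i := mul_div_cancel₀ _ hi.ne'
    · push Not at hp
      refine ⟨0, fun i => ?_⟩
      simpa using h0 i (le_antisymm (hp i) (hq i))

/-- Fourier–Motzkin elimination of one variable at a time. The row type varies in the induction
because the eliminated system is indexed by `ι × ι`: a pair with coefficients of signs `+`, `-`
gives the combination cancelling the first variable, a pair whose first row lacks that variable
gives this row, and all other pairs give the zero row. -/
theorem farkas_fin (n : ℕ) : ∀ (ι : Type) [Fintype ι] (A : ι → Fin n → ℚ) (b : ι → ℚ),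
    (∃ x : Fin n → ℚ, ∀ i, ∑ j, A i j * x j ≤ b i) ∨
      ∃ y : ι → ℚ, (∀ i, 0 ≤ y i) ∧ (∀ j, ∑ i, y i * A i j = 0) ∧ ∑ i, y i * b i < 0 := by
  classical
  induction n with
  | zero =>
    intro ι _ A b
    by_cases h : ∀ i, 0 ≤ b i
    · exact Or.inl ⟨0, by simpa using h⟩
    · push Not at h
      obtain ⟨i, hi⟩ := h
      refine Or.inr ⟨Pi.single i 1, fun k => ?_, fun j => j.elim0, ?_⟩
      · by_cases hk : k = i
        · subst hk; simp
        · simp [hk]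
      · simpa [Pi.single_apply] using hi
  | succ n ih =>
    intro ι _ A b
    -- The rows of the system in which the first variable is eliminated are combinations of the
    -- given rows with the coefficients `M`.
    let M : ι × ι → ι → ℚ := fun pq i =>
      if 0 < A pq.1 0 ∧ A pq.2 0 < 0 then
        (if i = pq.1 then -A pq.2 0 else 0) + (if i = pq.2 then A pq.1 0 else 0)
      else if A pq.1 0 = 0 then (if i = pq.1 then 1 else 0) else 0
    have hM0 : ∀ pq i, 0 ≤ M pq i := by
      intro pq i
      simp only [M]
      split_ifs with h <;> first | (have := h.1; have := h.2; linarith) | norm_num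
    have hMsum : ∀ pq (f : ι → ℚ), ∑ i, M pq i * f i =
        if 0 < A pq.1 0 ∧ A pq.2 0 < 0 then -A pq.2 0 * f pq.1 + A pq.1 0 * f pq.2
        else if A pq.1 0 = 0 then f pq.1 else 0 := by
      intro pq f
      simp only [M]
      split_ifs with h h'
      · simp [add_mul, Finset.sum_add_distrib, ite_mul]
      · simp
      · simp
    rcases ih (ι × ι) (fun pq j => ∑ i, M pq i * A i j.succ) (fun pq => ∑ i, M pq i * b i) with
      ⟨x, hx⟩ | ⟨y, hy0, hyA, hyb⟩
    · left
      have key : ∀ pq, 0 ≤ ∑ i, M pq i * (b i - ∑ j, A i j.succ * x j) := by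
        intro pq
        have h1 : ∑ j, (∑ i, M pq i * A i j.succ) * x j
            = ∑ i, M pq i * ∑ j, A i j.succ * x j := by
          simp only [Finset.sum_mul, Finset.mul_sum]
          rw [Finset.sum_comm]
          simp only [mul_assoc]
        have h2 := hx pq
        rw [h1] at h2
        simp only [mul_sub, Finset.sum_sub_distrib]
        linarith
      -- The diagonal pairs supply the rows without the first variable, the pairs of mixed sign the
      -- compatibility of upper and lower bounds.
      obtain ⟨x0, hx0⟩ := exists_forall_mul_le (fun i => A i 0)
        (fun i => b i - ∑ j, A i j.succ * x j)
        (fun i hi => by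
          have := key (i, i)
          rw [hMsum] at this
          simpa [hi] using this)
        (fun p q hp hq => by
          have := key (p, q)
          rw [hMsum] at this
          simpa [hp, hq] using this)
      refine ⟨Fin.cons x0 x, fun i => ?_⟩
      rw [Fin.sum_univ_succ]
      simp only [Fin.cons_zero, Fin.cons_succ]
      have := hx0 i
      linarith
    · right
      have swap : ∀ f : ι → ℚ, ∑ i, (∑ pq, y pq * M pq i) * f i
          = ∑ pq, y pq * ∑ i, M pq i * f i := by
        intro f
        simp only [Finset.sum_mul, Finset.mul_sum]
        rw [Finset.sum_comm]
        simp only [mul_assoc]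
      refine ⟨fun i => ∑ pq, y pq * M pq i,
        fun i => Finset.sum_nonneg fun pq _ => mul_nonneg (hy0 pq) (hM0 pq i), fun j => ?_, ?_⟩
      · rw [swap]
        -- The certificate is pulled back along `M`. In column `0` every combined row vanishes by
        -- the choice of `M`; the other columns are those of the eliminated system.
        refine Fin.cases ?_ (fun j => hyA j) j
        refine Finset.sum_eq_zero fun pq _ => ?_
        rw [hMsum]
        split_ifs with h h'
        · ring
        · rw [h', mul_zero]
        · rw [mul_zero]
      · rw [swap]
        exact hyb

/-- **Farkas' lemma**: a finite system of linear inequalities is solvable or it has a nonnegative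
combination which is contradictory. -/
theorem farkas {ι κ : Type} [Fintype ι] [Fintype κ] (A : ι → κ → ℚ) (b : ι → ℚ) :
    (∃ x : κ → ℚ, ∀ i, ∑ j, A i j * x j ≤ b i) ∨
      ∃ y : ι → ℚ, (∀ i, 0 ≤ y i) ∧ (∀ j, ∑ i, y i * A i j = 0) ∧ ∑ i, y i * b i < 0 := by
  let e := Fintype.equivFin κ
  rcases farkas_fin (Fintype.card κ) ι (fun i j => A i (e.symm j)) b with ⟨x, hx⟩ | ⟨y, hy, hA, hb⟩
  · refine Or.inl ⟨fun j => x (e j), fun i => ?_⟩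
    rw [← e.symm.sum_comp]
    simpa using hx i
  · exact Or.inr ⟨y, hy, fun j => by simpa using hA (e j), hb⟩

/-- A contradictory nonnegative combination refutes a system also over the real numbers. -/
theorem not_certificate_of_real_solution {ι κ : Type} [Fintype ι] [Fintype κ] (A : ι → κ → ℚ)
    (b : ι → ℚ) (x : κ → ℝ) (hx : ∀ i, ∑ j, (A i j : ℝ) * x j ≤ b i) (y : ι → ℚ)
    (hy : ∀ i, 0 ≤ y i) (hA : ∀ j, ∑ i, y i * A i j = 0) : 0 ≤ ∑ i, y i * b i := by
  have h1 : ∑ i, (y i : ℝ) * ∑ j, (A i j : ℝ) * x j ≤ ∑ i, (y i : ℝ) * b i :=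
    Finset.sum_le_sum fun i _ => mul_le_mul_of_nonneg_left (hx i) (by exact_mod_cast hy i)
  have h2 : ∑ i, (y i : ℝ) * ∑ j, (A i j : ℝ) * x j = 0 := by
    simp only [Finset.mul_sum]
    rw [Finset.sum_comm]
    refine Finset.sum_eq_zero fun j _ => ?_
    have : ((∑ i, y i * A i j : ℚ) : ℝ) = 0 := by rw [hA j]; simp
    push_cast at this
    simp only [← mul_assoc]
    rw [← Finset.sum_mul, this, zero_mul]
  rw [h2] at h1
  exact_mod_cast h1

end GNN

/-! ### From an instance and a shape to a rational linear system. -/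

namespace GNN

/-! ### Access to the code of an output reachability property -/

/-- A layer, together with the information whether it is the first layer of a combination
network, in which case its input is a node vector and an aggregate. -/
abbrev FlatLayer := Bool × LayerCode

/-- The layers of a network, the first one marked with `b`. -/
def markHead (b : Bool) (N : List LayerCode) : List FlatLayer :=
  List.casesOn N [] fun l ls => (b, l) :: ls.map fun l => (false, l)

/-- The sequence of all layers of the networks of an MPNN. -/
def flatNet (nets : List (List LayerCode)) : List FlatLayer :=
  -- A nonempty accumulator means that further networks follow, so `N` is not the readout and its
  -- first layer aggregates.
  nets.foldr (fun N acc => markHead (decide (0 < acc.length)) N ++ acc) []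

/-- The default `(0, 1)` codes the number `0`. Matrices and vectors are thereby padded with zeros,
and all dimensions can be replaced by the uniform bound `sizeBound c`. -/
def FlatLayer.weight (l : FlatLayer) (r j : ℕ) : Fr :=
  Fr.ofCode ((l.2.2.1.getD r []).getD j (0, 1))

def FlatLayer.bias (l : FlatLayer) (r : ℕ) : Fr := Fr.ofCode (l.2.2.2.1.getD r (0, 1))

/-- The dimension of the node vectors from which the input of the layer is formed. -/
def FlatLayer.nodeDim (l : FlatLayer) : ℕ := bif l.1 then l.2.1.1 / 2 else l.2.1.1

/-- The layer at position `t`; the default layer behind the end computes zero. -/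
def layerAt (c : NodeORPCode) (t : ℕ) : FlatLayer :=
  (flatNet c.2.1).getD t (false, (0, 0), [], [], false)

def numLayers (c : NodeORPCode) : ℕ := (flatNet c.2.1).length

/-- An upper bound for the number of layers, for the dimensions, for the number of inequalities in
each vector specification, and for the number of nodes to be considered and their distances from
the center. -/
def sizeBound (c : NodeORPCode) : ℕ :=
  (c.2.2.1.1 + 1) ^ c.2.1.length + c.2.1.length + numLayers c
    + sumLT (numLayers c) (fun t => (layerAt c t).2.1.1 + (layerAt c t).2.1.2)
    + c.1.1 + c.1.2 + sumLT c.2.2.1.2.2.length (fun i => (c.2.2.1.2.2.getD i []).length)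
    + c.2.2.2.length + 1

/-! ### Shapes

A shape consists of a graph on an initial segment of the natural numbers, the distances of its
nodes from the node `0`, and the phases of the ReLU units. It is written as a number in base
`sizeBound c + 1`. -/

def index4 (a b c d : ℕ) : ℕ := Nat.pair a (Nat.pair b (Nat.pair c d))

def digit (c : NodeORPCode) (s i : ℕ) : ℕ := s / (sizeBound c + 1) ^ i % (sizeBound c + 1)

def numNodes (c : NodeORPCode) (s : ℕ) : ℕ := digit c s (index4 0 0 0 0)

def shapeAdj (c : NodeORPCode) (s u w : ℕ) : Bool := digit c s (index4 1 u w 0) == 1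

def shapeDist (c : NodeORPCode) (s u : ℕ) : ℕ := digit c s (index4 2 u 0 0)

def phase (c : NodeORPCode) (s t u r : ℕ) : Bool := digit c s (index4 3 t u r) == 1

/-- The exponent exceeds every digit position in use, since `index4` is strictly increasing: the
tags are at most `3` and the other arguments at most `sizeBound c`. -/
def shapeBound (c : NodeORPCode) : ℕ :=
  (sizeBound c + 1) ^ index4 5 (sizeBound c + 1) (sizeBound c + 1) (sizeBound c + 1)

/-- The distances are verified locally: they grow by at most one along an edge, only node `0` has
distance `0`, and every other node has a neighbour one step closer. These conditions force them to
be the true distances from `0`. -/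
def shapeOK (c : NodeORPCode) (s : ℕ) : Bool :=
  decide (0 < numNodes c s) && (shapeDist c s 0 == 0) &&
  allLT (numNodes c s) fun u =>
    (allLT (numNodes c s) fun w => !(shapeAdj c s u w) ||
      (shapeAdj c s w u && decide (shapeDist c s w ≤ shapeDist c s u + 1))) &&
    decide (sumLT (numNodes c s) (fun w => bif shapeAdj c s u w then 1 else 0) ≤ c.2.2.1.1) &&
    (bif shapeDist c s u == 0 then u == 0 else
      anyLT (numNodes c s) fun w => shapeAdj c s w u && (shapeDist c s w + 1 == shapeDist c s u))

/-! ### The linear system for a shape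

The variables are the entries `j` of the vectors of the nodes `u` before layer `t`. -/

/-- The coefficients of the variables in the pre-activation `r` of the node `u` in layer `t`. -/
def preCoeff (c : NodeORPCode) (s t u r t' u' j' : ℕ) : Fr :=
  bif (t' == t) && decide (j' < (layerAt c t).nodeDim) then
    Fr.add (bif u' == u then (layerAt c t).weight r j' else Fr.zero)
      (bif (layerAt c t).1 && shapeAdj c s u u' then
        (layerAt c t).weight r ((layerAt c t).nodeDim + j') else Fr.zero)
  else Fr.zero

def reluAt (c : NodeORPCode) (t : ℕ) : Bool := (layerAt c t).2.2.2.2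

/-- An active unit passes on its pre-activation, an inactive one outputs `0`; with the phases fixed,
both are linear conditions. -/
def active (c : NodeORPCode) (s t u r : ℕ) : Bool := !(reluAt c t) || phase c s t u r

def layerCoeff (c : NodeORPCode) (s t u r t' u' j' : ℕ) : Fr :=
  Fr.add (bif (t' == t + 1) && ((u' == u) && (j' == r)) then Fr.one else Fr.zero)
    (Fr.neg (bif active c s t u r then preCoeff c s t u r t' u' j' else Fr.zero))

def layerRhs (c : NodeORPCode) (s t u r : ℕ) : Fr :=
  bif active c s t u r then (layerAt c t).bias r else Fr.zero

/-- The default is the inequality `0 ≤ 0`. It serves both as padding of short specifications and for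
nodes beyond the radius. -/
def inputIneq (c : NodeORPCode) (s u r : ℕ) : List RatCode × RatCode :=
  (c.2.2.1.2.2.getD (shapeDist c s u) []).getD r ([], (0, 1))

def outputIneq (c : NodeORPCode) (r : ℕ) : List RatCode × RatCode :=
  c.2.2.2.getD r ([], (0, 1))

/-- Kinds `0` and `1` are the two halves of the layer equation, kind `2` is the sign condition for
the guessed phase, kinds `3` and `4` are the input and output specifications. The last two ignore
`t`, and kind `4` ignores `u` as well, so their rows are merely repeated. -/
def rowCoeff (c : NodeORPCode) (s k t u r t' u' j' : ℕ) : Fr :=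
  bif k == 0 then layerCoeff c s t u r t' u' j'
  else bif k == 1 then Fr.neg (layerCoeff c s t u r t' u' j')
  else bif k == 2 then
    (bif reluAt c t then
      (bif phase c s t u r then Fr.neg (preCoeff c s t u r t' u' j')
        else preCoeff c s t u r t' u' j')
      else Fr.zero)
  else bif k == 3 then
    (bif (t' == 0) && (u' == u) then Fr.ofCode ((inputIneq c s u r).1.getD j' (0, 1)) else Fr.zero)
  else
    (bif (t' == numLayers c) && (u' == 0) then Fr.ofCode ((outputIneq c r).1.getD j' (0, 1))
      else Fr.zero)

def rowRhs (c : NodeORPCode) (s k t u r : ℕ) : Fr :=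
  bif k == 0 then layerRhs c s t u r
  else bif k == 1 then Fr.neg (layerRhs c s t u r)
  else bif k == 2 then
    (bif reluAt c t then
      (bif phase c s t u r then (layerAt c t).bias r else Fr.neg ((layerAt c t).bias r))
      else Fr.zero)
  else bif k == 3 then Fr.ofCode (inputIneq c s u r).2
  else Fr.ofCode (outputIneq c r).2

/-! ### Checking solutions and certificates -/

def solutionCheck (c : NodeORPCode) (s : ℕ) (x : List Fr) : Bool :=
  allLT 5 fun k => allLT (sizeBound c) fun t => allLT (numNodes c s) fun u =>
    allLT (sizeBound c) fun r =>
      Fr.le (Fr.sum (sizeBound c + 1) fun t' => Fr.sum (numNodes c s) fun u' =>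
          Fr.sum (sizeBound c) fun j' =>
            Fr.mul (rowCoeff c s k t u r t' u' j') (x.getD (index4 0 t' u' j') Fr.zero))
        (rowRhs c s k t u r)

/-- The combination of the quantities `f` of the rows with the coefficients `y`. -/
def combination (c : NodeORPCode) (s : ℕ) (y : List Fr) (f : ℕ → ℕ → ℕ → ℕ → Fr) : Fr :=
  Fr.sum 5 fun k => Fr.sum (sizeBound c) fun t => Fr.sum (numNodes c s) fun u =>
    Fr.sum (sizeBound c) fun r => Fr.mul (y.getD (index4 k t u r) Fr.zero) (f k t u r)

/-- Vanishing is tested by two comparisons because a rational number has many triples. -/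
def certificateCheck (c : NodeORPCode) (s : ℕ) (y : List Fr) : Bool :=
  (allLT 5 fun k => allLT (sizeBound c) fun t => allLT (numNodes c s) fun u =>
    allLT (sizeBound c) fun r => Fr.le Fr.zero (y.getD (index4 k t u r) Fr.zero)) &&
  (allLT (sizeBound c + 1) fun t' => allLT (numNodes c s) fun u' => allLT (sizeBound c) fun j' =>
    Fr.le (combination c s y fun k t u r => rowCoeff c s k t u r t' u' j') Fr.zero &&
    Fr.le Fr.zero (combination c s y fun k t u r => rowCoeff c s k t u r t' u' j')) &&
  !(Fr.le Fr.zero (combination c s y (rowRhs c s)))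

/-! ### Primitive recursiveness -/

section

variable {α : Type*} [Primcodable α]

theorem primrec_markHead : Primrec₂ markHead := by
  refine Primrec.list_casesOn (f := fun p : Bool × List LayerCode => p.2) (g := fun _ => [])
    (h := fun p q => (p.1, q.1) :: q.2.map fun l => (false, l)) Primrec.snd (Primrec.const _) ?_
  refine Primrec.list_cons.comp (by fun_prop) ?_
  exact Primrec.list_map (by fun_prop) (g := fun _ l => (false, l))
    (show Primrec fun p : _ × _ => _ by fun_prop)

@[fun_prop] theorem primrec_flatNet {f : α → List (List LayerCode)} (hf : Primrec f) :
    Primrec fun a => flatNet (f a) := by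
  refine Primrec.list_foldr hf (Primrec.const [])
    (h := fun _ p => markHead (decide (0 < p.2.length)) p.1 ++ p.2) ?_
  exact Primrec.list_append.comp (primrec_markHead.comp (by fun_prop) (by fun_prop)) (by fun_prop)

@[fun_prop] theorem primrec_weight {f : α → FlatLayer} {g h : α → ℕ} (hf : Primrec f)
    (hg : Primrec g) (hh : Primrec h) : Primrec fun a => (f a).weight (g a) (h a) := by
  unfold FlatLayer.weight; fun_prop

@[fun_prop] theorem primrec_bias {f : α → FlatLayer} {g : α → ℕ} (hf : Primrec f)
    (hg : Primrec g) : Primrec fun a => (f a).bias (g a) := by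
  unfold FlatLayer.bias; fun_prop

@[fun_prop] theorem primrec_nodeDim {f : α → FlatLayer} (hf : Primrec f) :
    Primrec fun a => (f a).nodeDim := by
  unfold FlatLayer.nodeDim; fun_prop

variable {c : α → NodeORPCode}

@[fun_prop] theorem primrec_layerAt {t : α → ℕ} (hc : Primrec c) (ht : Primrec t) :
    Primrec fun a => layerAt (c a) (t a) := by
  unfold layerAt; fun_prop

@[fun_prop] theorem primrec_numLayers (hc : Primrec c) : Primrec fun a => numLayers (c a) := by
  unfold numLayers; fun_prop

@[fun_prop] theorem primrec_sizeBound (hc : Primrec c) : Primrec fun a => sizeBound (c a) := by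
  unfold sizeBound; fun_prop

end

section

variable {α : Type*} [Primcodable α]

@[fun_prop] theorem primrec_index4 {f g h i : α → ℕ} (hf : Primrec f) (hg : Primrec g)
    (hh : Primrec h) (hi : Primrec i) : Primrec fun a => index4 (f a) (g a) (h a) (i a) := by
  unfold index4; fun_prop

variable {c : α → NodeORPCode} {s k t u r t' u' j' : α → ℕ} {x : α → List Fr}

@[fun_prop] theorem primrec_digit (hc : Primrec c) (hs : Primrec s) (ht : Primrec t) :
    Primrec fun a => digit (c a) (s a) (t a) := by unfold digit; fun_prop

@[fun_prop] theorem primrec_numNodes (hc : Primrec c) (hs : Primrec s) :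
    Primrec fun a => numNodes (c a) (s a) := by unfold numNodes; fun_prop

@[fun_prop] theorem primrec_shapeAdj (hc : Primrec c) (hs : Primrec s) (ht : Primrec t)
    (hu : Primrec u) : Primrec fun a => shapeAdj (c a) (s a) (t a) (u a) := by
  unfold shapeAdj; fun_prop

@[fun_prop] theorem primrec_shapeDist (hc : Primrec c) (hs : Primrec s) (ht : Primrec t) :
    Primrec fun a => shapeDist (c a) (s a) (t a) := by unfold shapeDist; fun_prop

@[fun_prop] theorem primrec_phase (hc : Primrec c) (hs : Primrec s) (ht : Primrec t)
    (hu : Primrec u) (hr : Primrec r) :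
    Primrec fun a => phase (c a) (s a) (t a) (u a) (r a) := by
  unfold phase; fun_prop

theorem primrec_shapeBound (hc : Primrec c) : Primrec fun a => shapeBound (c a) := by
  unfold shapeBound; fun_prop

theorem primrec_shapeOK (hc : Primrec c) (hs : Primrec s) :
    Primrec fun a => shapeOK (c a) (s a) := by
  unfold shapeOK; fun_prop

@[fun_prop] theorem primrec_preCoeff (hc : Primrec c) (hs : Primrec s) (ht : Primrec t)
    (hu : Primrec u) (hr : Primrec r) (ht' : Primrec t') (hu' : Primrec u') (hj' : Primrec j') :
    Primrec fun a => preCoeff (c a) (s a) (t a) (u a) (r a) (t' a) (u' a) (j' a) := by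
  unfold preCoeff; fun_prop

@[fun_prop] theorem primrec_reluAt (hc : Primrec c) (ht : Primrec t) :
    Primrec fun a => reluAt (c a) (t a) := by unfold reluAt; fun_prop

@[fun_prop] theorem primrec_active (hc : Primrec c) (hs : Primrec s) (ht : Primrec t)
    (hu : Primrec u) (hr : Primrec r) :
    Primrec fun a => active (c a) (s a) (t a) (u a) (r a) := by
  unfold active; fun_prop

@[fun_prop] theorem primrec_layerCoeff (hc : Primrec c) (hs : Primrec s) (ht : Primrec t)
    (hu : Primrec u) (hr : Primrec r) (ht' : Primrec t') (hu' : Primrec u') (hj' : Primrec j') :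
    Primrec fun a => layerCoeff (c a) (s a) (t a) (u a) (r a) (t' a) (u' a) (j' a) := by
  unfold layerCoeff; fun_prop

@[fun_prop] theorem primrec_layerRhs (hc : Primrec c) (hs : Primrec s) (ht : Primrec t)
    (hu : Primrec u) (hr : Primrec r) :
    Primrec fun a => layerRhs (c a) (s a) (t a) (u a) (r a) := by
  unfold layerRhs; fun_prop

@[fun_prop] theorem primrec_inputIneq (hc : Primrec c) (hs : Primrec s) (hu : Primrec u)
    (hr : Primrec r) : Primrec fun a => inputIneq (c a) (s a) (u a) (r a) := by
  unfold inputIneq; fun_prop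

@[fun_prop] theorem primrec_outputIneq (hc : Primrec c) (hr : Primrec r) :
    Primrec fun a => outputIneq (c a) (r a) := by
  unfold outputIneq; fun_prop

@[fun_prop] theorem primrec_rowCoeff (hc : Primrec c) (hs : Primrec s) (hk : Primrec k)
    (ht : Primrec t) (hu : Primrec u) (hr : Primrec r) (ht' : Primrec t') (hu' : Primrec u')
    (hj' : Primrec j') :
    Primrec fun a => rowCoeff (c a) (s a) (k a) (t a) (u a) (r a) (t' a) (u' a) (j' a) := by
  unfold rowCoeff; fun_prop

@[fun_prop] theorem primrec_rowRhs (hc : Primrec c) (hs : Primrec s) (hk : Primrec k)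
    (ht : Primrec t) (hu : Primrec u) (hr : Primrec r) :
    Primrec fun a => rowRhs (c a) (s a) (k a) (t a) (u a) (r a) := by
  unfold rowRhs; fun_prop

@[fun_prop] theorem primrec_solutionCheck (hc : Primrec c) (hs : Primrec s) (hx : Primrec x) :
    Primrec fun a => solutionCheck (c a) (s a) (x a) := by
  unfold solutionCheck; fun_prop

@[fun_prop] theorem primrec_certificateCheck (hc : Primrec c) (hs : Primrec s)
    (hx : Primrec x) : Primrec fun a => certificateCheck (c a) (s a) (x a) := by
  unfold certificateCheck combination; fun_prop

end

end GNN

/-! ### Decidability of the systems and computability of the search. -/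

namespace GNN

open Finset

/-! ### Deciding the linear systems -/

/-- Real solutions of the linear system for a shape. -/
def RealSat (c : NodeORPCode) (s : ℕ) (X : ℕ → ℕ → ℕ → ℝ) : Prop :=
  ∀ k < 5, ∀ t < sizeBound c, ∀ u < numNodes c s, ∀ r < sizeBound c,
    ∑ t' ∈ range (sizeBound c + 1), ∑ u' ∈ range (numNodes c s), ∑ j' ∈ range (sizeBound c),
      ((rowCoeff c s k t u r t' u' j').val : ℝ) * X t' u' j' ≤ ((rowRhs c s k t u r).val : ℝ)

abbrev RowIndex (c : NodeORPCode) (s : ℕ) : Type :=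
  Fin 5 × Fin (sizeBound c) × Fin (numNodes c s) × Fin (sizeBound c)

abbrev VarIndex (c : NodeORPCode) (s : ℕ) : Type :=
  Fin (sizeBound c + 1) × Fin (numNodes c s) × Fin (sizeBound c)

def matrixOf (c : NodeORPCode) (s : ℕ) (i : RowIndex c s) (j : VarIndex c s) : ℚ :=
  (rowCoeff c s i.1 i.2.1 i.2.2.1 i.2.2.2 j.1 j.2.1 j.2.2).val

def rhsOf (c : NodeORPCode) (s : ℕ) (i : RowIndex c s) : ℚ :=
  (rowRhs c s i.1 i.2.1 i.2.2.1 i.2.2.2).val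

theorem sum_varIndex {M : Type*} [AddCommMonoid M] (c : NodeORPCode) (s : ℕ)
    (f : ℕ → ℕ → ℕ → M) :
    ∑ j : VarIndex c s, f j.1 j.2.1 j.2.2 =
      ∑ t' ∈ range (sizeBound c + 1), ∑ u' ∈ range (numNodes c s), ∑ j' ∈ range (sizeBound c),
        f t' u' j' := by
  simp only [Fintype.sum_prod_type, sum_range]

theorem sum_rowIndex {M : Type*} [AddCommMonoid M] (c : NodeORPCode) (s : ℕ)
    (f : ℕ → ℕ → ℕ → ℕ → M) :
    ∑ i : RowIndex c s, f i.1 i.2.1 i.2.2.1 i.2.2.2 =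
      ∑ k ∈ range 5, ∑ t ∈ range (sizeBound c), ∑ u ∈ range (numNodes c s),
        ∑ r ∈ range (sizeBound c), f k t u r := by
  simp only [Fintype.sum_prod_type, sum_range]

theorem forall_rowIndex (c : NodeORPCode) (s : ℕ) (p : ℕ → ℕ → ℕ → ℕ → Prop) :
    (∀ i : RowIndex c s, p i.1 i.2.1 i.2.2.1 i.2.2.2) ↔
      ∀ k < 5, ∀ t < sizeBound c, ∀ u < numNodes c s, ∀ r < sizeBound c, p k t u r :=
  ⟨fun h k hk t ht u hu r hr => h (⟨k, hk⟩, ⟨t, ht⟩, ⟨u, hu⟩, ⟨r, hr⟩),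
    fun h i => h _ i.1.2 _ i.2.1.2 _ i.2.2.1.2 _ i.2.2.2.2⟩

theorem forall_varIndex (c : NodeORPCode) (s : ℕ) (p : ℕ → ℕ → ℕ → Prop) :
    (∀ i : VarIndex c s, p i.1 i.2.1 i.2.2) ↔
      ∀ t < sizeBound c + 1, ∀ u < numNodes c s, ∀ r < sizeBound c, p t u r :=
  ⟨fun h t ht u hu r hr => h (⟨t, ht⟩, ⟨u, hu⟩, ⟨r, hr⟩),
    fun h i => h _ i.1.2 _ i.2.1.2 _ i.2.2.2⟩

theorem solutionCheck_iff (c : NodeORPCode) (s : ℕ) (x : List Fr) :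
    solutionCheck c s x = true ↔ ∀ i : RowIndex c s,
      ∑ j : VarIndex c s, matrixOf c s i j * (x.getD (index4 0 j.1 j.2.1 j.2.2) Fr.zero).val
        ≤ rhsOf c s i := by
  simp only [matrixOf, rhsOf]
  rw [forall_rowIndex c s (fun k t u r => ∑ j : VarIndex c s,
    (rowCoeff c s k t u r j.1 j.2.1 j.2.2).val * (x.getD (index4 0 j.1 j.2.1 j.2.2) Fr.zero).val
      ≤ (rowRhs c s k t u r).val)]
  have hsum := fun k t u r => sum_varIndex c s (fun t' u' j' =>
    (rowCoeff c s k t u r t' u' j').val * (x.getD (index4 0 t' u' j') Fr.zero).val)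
  simp only [hsum, solutionCheck, allLT_iff, Fr.le_iff, Fr.val_sum, Fr.val_mul]

theorem val_combination (c : NodeORPCode) (s : ℕ) (y : List Fr) (f : ℕ → ℕ → ℕ → ℕ → Fr) :
    (combination c s y f).val = ∑ i : RowIndex c s,
      (y.getD (index4 i.1 i.2.1 i.2.2.1 i.2.2.2) Fr.zero).val *
        (f i.1 i.2.1 i.2.2.1 i.2.2.2).val := by
  rw [sum_rowIndex c s (fun k t u r => (y.getD (index4 k t u r) Fr.zero).val * (f k t u r).val)]
  simp only [combination, Fr.val_sum, Fr.val_mul]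

theorem certificateCheck_iff (c : NodeORPCode) (s : ℕ) (y : List Fr) :
    certificateCheck c s y = true ↔
      (∀ i : RowIndex c s,
        0 ≤ (y.getD (index4 i.1 i.2.1 i.2.2.1 i.2.2.2) Fr.zero).val) ∧
      (∀ j : VarIndex c s, ∑ i : RowIndex c s,
        (y.getD (index4 i.1 i.2.1 i.2.2.1 i.2.2.2) Fr.zero).val * matrixOf c s i j = 0) ∧
      ∑ i : RowIndex c s,
        (y.getD (index4 i.1 i.2.1 i.2.2.1 i.2.2.2) Fr.zero).val * rhsOf c s i < 0 := by
  have h0 : Fr.val Fr.zero = 0 := Fr.val_zero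
  rw [forall_rowIndex c s (fun k t u r => 0 ≤ (y.getD (index4 k t u r) Fr.zero).val)]
  simp only [matrixOf, rhsOf]
  rw [forall_varIndex c s (fun t' u' j' => ∑ i : RowIndex c s,
    (y.getD (index4 i.1 i.2.1 i.2.2.1 i.2.2.2) Fr.zero).val *
      (rowCoeff c s i.1 i.2.1 i.2.2.1 i.2.2.2 t' u' j').val = 0)]
  simp only [certificateCheck, Bool.and_eq_true, Bool.not_eq_true', ← Bool.not_eq_true, allLT_iff,
    Fr.le_iff, h0, val_combination, not_le, and_assoc, le_antisymm_iff (α := ℚ)]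

theorem index4_lt {a b c d a' b' c' d' : ℕ} (ha : a < a') (hb : b < b') (hc : c < c')
    (hd : d < d') : index4 a b c d < index4 a' b' c' d' := by
  have key : ∀ {m n m' n' : ℕ}, m < m' → n < n' → Nat.pair m n < Nat.pair m' n' :=
    fun hm hn => (Nat.pair_lt_pair_left _ hm).trans (Nat.pair_lt_pair_right _ hn)
  exact key ha (key hb (key hc hd))

/-- Every finite table of rational numbers is the table of a list of triples. -/
theorem exists_list_val (B : ℕ) (f : ℕ → ℕ → ℕ → ℕ → ℚ) :
    ∃ l : List Fr, ∀ a < B, ∀ b < B, ∀ c < B, ∀ d < B,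
      (l.getD (index4 a b c d) Fr.zero).val = f a b c d := by
  choose g hg using Fr.exists_val
  let F : ℕ → Fr := fun i =>
    g (f i.unpair.1 i.unpair.2.unpair.1 i.unpair.2.unpair.2.unpair.1 i.unpair.2.unpair.2.unpair.2)
  refine ⟨(List.range (index4 B B B B)).map F, fun a ha b hb c hc d hd => ?_⟩
  have hlt := index4_lt ha hb hc hd
  rw [List.getD_eq_getElem _ _ (by simpa using hlt)]
  simp [F, hg, index4]

/-- Both alternatives of Farkas' lemma provide rational tables, hence lists of triples. This makes
the search below total. -/
theorem exists_check (c : NodeORPCode) (s : ℕ) :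
    (∃ x, solutionCheck c s x = true) ∨ ∃ y, certificateCheck c s y = true := by
  have hbd : ∀ x, x ≤ max 5 (max (sizeBound c + 1) (numNodes c s)) →
      x < max 5 (max (sizeBound c + 1) (numNodes c s)) + 1 := fun x hx => by omega
  rcases farkas (matrixOf c s) (rhsOf c s) with ⟨x, hx⟩ | ⟨y, hy, hA, hb⟩
  · left
    obtain ⟨l, hl⟩ := exists_list_val (max 5 (max (sizeBound c + 1) (numNodes c s)) + 1)
      fun _ t u j => if h : t < sizeBound c + 1 ∧ u < numNodes c s ∧ j < sizeBound c then
        x (⟨t, h.1⟩, ⟨u, h.2.1⟩, ⟨j, h.2.2⟩) else 0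
    refine ⟨l, (solutionCheck_iff c s l).2 fun i => ?_⟩
    refine le_of_eq_of_le (sum_congr rfl fun j _ => ?_) (hx i)
    have h1 := j.1.2
    have h2 := j.2.1.2
    have h3 := j.2.2.2
    rw [hl 0 (by omega) _ (by omega) _ (by omega) _ (by omega), dif_pos ⟨h1, h2, h3⟩]
  · right
    obtain ⟨l, hl⟩ := exists_list_val (max 5 (max (sizeBound c + 1) (numNodes c s)) + 1)
      fun k t u r => if h : k < 5 ∧ t < sizeBound c ∧ u < numNodes c s ∧ r < sizeBound c then
        y (⟨k, h.1⟩, ⟨t, h.2.1⟩, ⟨u, h.2.2.1⟩, ⟨r, h.2.2.2⟩) else 0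
    have hy' : ∀ i : RowIndex c s,
        (l.getD (index4 i.1 i.2.1 i.2.2.1 i.2.2.2) Fr.zero).val = y i := by
      intro i
      have h1 := i.1.2
      have h2 := i.2.1.2
      have h3 := i.2.2.1.2
      have h4 := i.2.2.2.2
      rw [hl _ (by omega) _ (by omega) _ (by omega) _ (by omega), dif_pos ⟨h1, h2, h3, h4⟩]
    refine ⟨l, (certificateCheck_iff c s l).2 ?_⟩
    simp only [hy']
    exact ⟨hy, hA, hb⟩

theorem RealSat.not_certificateCheck {c : NodeORPCode} {s : ℕ} {X : ℕ → ℕ → ℕ → ℝ}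
    (h : RealSat c s X) (y : List Fr) : ¬ certificateCheck c s y = true := by
  rw [certificateCheck_iff]
  rintro ⟨h1, h2, h3⟩
  refine h3.not_ge (not_certificate_of_real_solution (matrixOf c s) (rhsOf c s)
    (fun j => X j.1 j.2.1 j.2.2) (fun i => ?_) _ h1 h2)
  have := h i.1 i.1.2 i.2.1 i.2.1.2 i.2.2.1 i.2.2.1.2 i.2.2.2 i.2.2.2.2
  rw [← sum_varIndex c s (fun t' u' j' =>
    ((rowCoeff c s i.1 i.2.1 i.2.2.1 i.2.2.2 t' u' j').val : ℝ) * X t' u' j')] at this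
  exact this

theorem exists_realSat_of_solutionCheck {c : NodeORPCode} {s : ℕ} {x : List Fr}
    (h : solutionCheck c s x = true) : ∃ X, RealSat c s X := by
  refine ⟨fun t u j => ((x.getD (index4 0 t u j) Fr.zero).val : ℝ), ?_⟩
  intro k hk t ht u hu r hr
  simp only [solutionCheck, allLT_iff, Fr.le_iff, Fr.val_sum, Fr.val_mul] at h
  beta_reduce
  exact_mod_cast h k hk t ht u hu r hr

def decodeWitness (w : ℕ) : List Fr := (Encodable.decode (α := List Fr) w).getD []

def witnessCheck (c : NodeORPCode) (s w : ℕ) : Bool :=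
  solutionCheck c s (decodeWitness w) || certificateCheck c s (decodeWitness w)

theorem exists_witnessCheck (c : NodeORPCode) (s : ℕ) : ∃ w, witnessCheck c s w = true := by
  rcases exists_check c s with ⟨x, hx⟩ | ⟨x, hx⟩ <;>
    exact ⟨Encodable.encode x, by simp [witnessCheck, decodeWitness, hx]⟩

/-- Solvability of the linear system for a shape, decided by searching for a solution and for a
contradictory combination of its inequalities at the same time. -/
def feasible (c : NodeORPCode) (s : ℕ) : Bool :=
  solutionCheck c s (decodeWitness (Nat.find (exists_witnessCheck c s)))

/-- A real solution rules out every certificate, so the first witness found must then be a rational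
solution. -/
theorem feasible_iff (c : NodeORPCode) (s : ℕ) : feasible c s = true ↔ ∃ X, RealSat c s X := by
  refine ⟨exists_realSat_of_solutionCheck, fun ⟨X, hX⟩ => ?_⟩
  have h := Nat.find_spec (exists_witnessCheck c s)
  rw [witnessCheck, Bool.or_eq_true] at h
  exact h.resolve_right (hX.not_certificateCheck _)

theorem primrec_decodeWitness : Primrec decodeWitness :=
  Primrec.option_getD.comp Primrec.decode (Primrec.const [])

theorem computable_feasible : Computable₂ feasible := by
  have hw : Primrec fun p : (NodeORPCode × ℕ) × ℕ => witnessCheck p.1.1 p.1.2 p.2 := by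
    have h := primrec_decodeWitness
    unfold witnessCheck
    fun_prop
  have hfind : Computable fun p : NodeORPCode × ℕ => Nat.find (exists_witnessCheck p.1 p.2) := by
    -- The unbounded search `Nat.rfind` is partial recursive, and it returns the value of `Nat.find`
    -- because a witness always exists.
    refine Partrec.of_eq_tot (f := fun p : NodeORPCode × ℕ =>
      Nat.rfind fun w => Part.some (witnessCheck p.1 p.2 w)) ?_ fun p => ?_
    · exact Partrec.rfind (p := fun (p : NodeORPCode × ℕ) w => Part.some (witnessCheck p.1 p.2 w))
        hw.to_comp
    · refine Nat.mem_rfind.2 ⟨?_, fun {m} hm => ?_⟩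
      · simpa using Nat.find_spec (exists_witnessCheck p.1 p.2)
      · simpa using Nat.find_min (exists_witnessCheck p.1 p.2) hm
  have hs : Primrec fun q : (NodeORPCode × ℕ) × ℕ =>
      solutionCheck q.1.1 q.1.2 (decodeWitness q.2) := by
    have h := primrec_decodeWitness
    fun_prop
  exact (hs.to_comp.comp (Computable.id.pair hfind)).of_eq fun _ => rfl

/-- The decision procedure: search through all shapes. -/
def decision (c : NodeORPCode) : Bool :=
  anyLT (shapeBound c) fun s => shapeOK c s && feasible c s

/-- Since `feasible` is shown only to be computable, `primrec_anyLT` does not apply; the recursion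
behind `anyLT` is used directly. -/
theorem computable_decision : Computable decision := by
  refine Computable.nat_rec (f := shapeBound) (g := fun _ => false)
    (h := fun c p => p.2 || (shapeOK c p.1 && feasible c p.1))
    (primrec_shapeBound Primrec.id).to_comp (Computable.const _) ?_
  have h1 : Computable fun q : NodeORPCode × ℕ × Bool => shapeOK q.1 q.2.1 :=
    (primrec_shapeOK (c := fun q : NodeORPCode × ℕ × Bool => q.1) (s := fun q => q.2.1)
      (by fun_prop) (by fun_prop)).to_comp
  have h2 : Computable fun q : NodeORPCode × ℕ × Bool => feasible q.1 q.2.1 :=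
    Computable₂.comp computable_feasible Computable.fst (Computable.fst.comp Computable.snd)
  exact Computable₂.comp Primrec.or.to_comp (Computable.snd.comp Computable.snd)
    (Computable₂.comp Primrec.and.to_comp h1 h2)

end GNN

/-! ### Meaning of the rows of the linear system. -/

namespace GNN

open Finset

/-! ### Real solutions are traces of the network -/

/-- The linear part of the pre-activation of a layer on a graph on `{0, …, n - 1}`. -/
noncomputable def FlatLayer.lin (l : FlatLayer) (n : ℕ) (adj : ℕ → ℕ → Bool) (x : ℕ → ℕ → ℝ)
    (u r : ℕ) : ℝ :=
  ∑ j ∈ range l.nodeDim, (((l.weight r j).val : ℝ) * x u j +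
    if l.1 = true then ((l.weight r (l.nodeDim + j)).val : ℝ) *
      ∑ w ∈ range n, (if adj u w = true then x w j else 0) else 0)

/-- The node vectors after a layer. -/
noncomputable def FlatLayer.eval (l : FlatLayer) (n : ℕ) (adj : ℕ → ℕ → Bool) (x : ℕ → ℕ → ℝ)
    (u r : ℕ) : ℝ :=
  if l.2.2.2.2 = true then max 0 (l.lin n adj x u r + (l.bias r).val)
  else l.lin n adj x u r + (l.bias r).val

/-- Satisfaction of a coded linear inequality by the first `K` entries of a sequence. -/
def IneqSat (K : ℕ) (q : List RatCode × RatCode) (x : ℕ → ℝ) : Prop :=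
  ∑ j ∈ range K, ((Fr.ofCode (q.1.getD j (0, 1))).val : ℝ) * x j ≤ (Fr.ofCode q.2).val

theorem val_preCoeff (c : NodeORPCode) (s t u r t' u' j' : ℕ) :
    (preCoeff c s t u r t' u' j').val =
      if t' = t then (if j' < (layerAt c t).nodeDim then
        (if u' = u then ((layerAt c t).weight r j').val else 0) +
        (if (layerAt c t).1 = true then (if shapeAdj c s u u' = true then
          ((layerAt c t).weight r ((layerAt c t).nodeDim + j')).val else 0) else 0) else 0)
      else 0 := by
  simp only [preCoeff, Bool.cond_eq_ite, Bool.and_eq_true, beq_iff_eq, decide_eq_true_eq,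
    apply_ite Fr.val, Fr.val_add, Fr.val_zero, ite_and]

theorem nodeDim_layerAt_le (c : NodeORPCode) (t : ℕ) :
    (layerAt c t).nodeDim ≤ (layerAt c t).2.1.1 := by
  unfold FlatLayer.nodeDim
  cases (layerAt c t).1
  · exact le_rfl
  · exact Nat.div_le_self _ _

theorem layerAt_of_le {c : NodeORPCode} {t : ℕ} (h : numLayers c ≤ t) :
    layerAt c t = (false, (0, 0), [], [], false) := by
  unfold layerAt
  exact List.getD_eq_default _ _ h

theorem dims_layerAt_le (c : NodeORPCode) (t : ℕ) :
    (layerAt c t).2.1.1 + (layerAt c t).2.1.2 ≤ sizeBound c := by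
  by_cases h : t < numLayers c
  · have := single_le_sum (f := fun t => (layerAt c t).2.1.1 + (layerAt c t).2.1.2)
      (fun _ _ => Nat.zero_le _) (mem_range.2 h)
    unfold sizeBound
    rw [sumLT_eq]
    omega
  · rw [layerAt_of_le (not_lt.1 h)]
    exact Nat.zero_le _

theorem numLayers_lt (c : NodeORPCode) : numLayers c < sizeBound c := by
  unfold sizeBound
  omega

/-- The coefficients are supported on `t' = t` and `j' < nodeDim`. As `nodeDim` is at most
`sizeBound c`, the uniform summation range loses nothing. -/
theorem sum_preCoeff (c : NodeORPCode) (s t u r : ℕ) (X : ℕ → ℕ → ℕ → ℝ) (ht : t < sizeBound c)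
    (hu : u < numNodes c s) :
    ∑ t' ∈ range (sizeBound c + 1), ∑ u' ∈ range (numNodes c s), ∑ j' ∈ range (sizeBound c),
      ((preCoeff c s t u r t' u' j').val : ℝ) * X t' u' j' =
    (layerAt c t).lin (numNodes c s) (shapeAdj c s) (X t) u r := by
  have hdim := (nodeDim_layerAt_le c t).trans ((Nat.le_add_right _ _).trans (dims_layerAt_le c t))
  rw [sum_eq_single_of_mem t (mem_range.2 (by omega))
    (fun t' _ h => sum_eq_zero fun u' _ => sum_eq_zero fun j' _ => by simp [val_preCoeff, h])]
  rw [sum_comm, ← sum_subset (range_subset_range.2 hdim)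
    (fun j' _ h => sum_eq_zero fun u' _ => by
      rw [mem_range] at h
      simp [val_preCoeff, h])]
  refine sum_congr rfl fun j hj => ?_
  rw [mem_range] at hj
  simp only [val_preCoeff, hj, if_true, Rat.cast_add, add_mul, sum_add_distrib]
  congr 1
  · rw [sum_eq_single_of_mem u (mem_range.2 hu) (fun u' _ h => by simp [h])]
    simp
  · by_cases h : (layerAt c t).1 = true
    · simp only [h, if_true, mul_sum]
      refine sum_congr rfl fun w _ => ?_
      split_ifs <;> simp
    · simp [h]

theorem val_layerCoeff (c : NodeORPCode) (s t u r t' u' j' : ℕ) :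
    ((layerCoeff c s t u r t' u' j').val : ℝ) =
      (if t' = t + 1 then (if u' = u then (if j' = r then 1 else 0) else 0) else 0) -
      (if active c s t u r = true then 1 else 0) * (preCoeff c s t u r t' u' j').val := by
  unfold layerCoeff
  by_cases h1 : t' = t + 1 <;> by_cases h2 : u' = u <;> by_cases h3 : j' = r <;>
    by_cases h4 : active c s t u r = true <;>
    simp [Bool.cond_eq_ite, h1, h2, h3, h4, Fr.val_add, Fr.val_neg, Fr.val_zero, Fr.val_one, sub_eq_add_neg]

theorem sum_layerCoeff (c : NodeORPCode) (s t u r : ℕ) (X : ℕ → ℕ → ℕ → ℝ) (ht : t < sizeBound c)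
    (hu : u < numNodes c s) (hr : r < sizeBound c) :
    ∑ t' ∈ range (sizeBound c + 1), ∑ u' ∈ range (numNodes c s), ∑ j' ∈ range (sizeBound c),
      ((layerCoeff c s t u r t' u' j').val : ℝ) * X t' u' j' =
    X (t + 1) u r - (if active c s t u r = true then 1 else 0) *
      (layerAt c t).lin (numNodes c s) (shapeAdj c s) (X t) u r := by
  rw [← sum_preCoeff c s t u r X ht hu]
  simp only [val_layerCoeff, sub_mul, sum_sub_distrib, mul_sum, mul_assoc]
  congr 1
  rw [sum_eq_single_of_mem (t + 1) (mem_range.2 (by omega)) (fun t' _ h => by simp [h]),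
    sum_eq_single_of_mem u (mem_range.2 hu) (fun t' _ h => by simp [h]),
    sum_eq_single_of_mem r (mem_range.2 hr) (fun t' _ h => by simp [h])]
  simp

theorem sum_ineqCoeff {T n K : ℕ} (p : List RatCode) {t u : ℕ} (ht : t < T) (hu : u < n)
    (X : ℕ → ℕ → ℕ → ℝ) :
    ∑ t' ∈ range T, ∑ u' ∈ range n, ∑ j' ∈ range K,
      ((bif (t' == t) && (u' == u) then Fr.ofCode (p.getD j' (0, 1)) else Fr.zero).val : ℝ) *
        X t' u' j' =
    ∑ j ∈ range K, ((Fr.ofCode (p.getD j (0, 1))).val : ℝ) * X t u j := by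
  rw [sum_eq_single_of_mem t (mem_range.2 ht) (fun t' _ h => by
      simp [Bool.cond_eq_ite, h, Fr.val_zero]),
    sum_eq_single_of_mem u (mem_range.2 hu) (fun t' _ h => by simp [Bool.cond_eq_ite, h, Fr.val_zero])]
  simp

theorem val_layerRhs (c : NodeORPCode) (s t u r : ℕ) : ((layerRhs c s t u r).val : ℝ) =
    (if active c s t u r = true then 1 else 0) * ((layerAt c t).bias r).val := by
  unfold layerRhs
  by_cases h4 : active c s t u r = true <;> simp [h4, Fr.val_zero]

/-- The rows of the linear system for one unit express that its output is computed from its input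
and that the guessed phase is correct. -/
theorem unit_rows_iff (relu ph : Bool) (x y b : ℝ) :
    (x - (if (!relu || ph) = true then 1 else 0) * y ≤
        (if (!relu || ph) = true then 1 else 0) * b ∧
      -(x - (if (!relu || ph) = true then 1 else 0) * y) ≤
        -((if (!relu || ph) = true then 1 else 0) * b) ∧
      (relu = true → if ph = true then -y ≤ b else y ≤ -b)) ↔
    (x = if relu = true then max 0 (y + b) else y + b) ∧
      (relu = true → if ph = true then 0 ≤ y + b else y + b ≤ 0) := by
  cases relu <;> cases ph <;> simp
  · constructor
    · rintro ⟨h1, h2⟩; linarith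
    · intro h; constructor <;> linarith
  · constructor
    · rintro ⟨h1, h2⟩; linarith
    · intro h; constructor <;> linarith
  · constructor
    · rintro ⟨h1, h2, h3⟩
      refine ⟨?_, by linarith⟩
      rw [max_eq_left (by linarith)]
      linarith
    · rintro ⟨h1, h2⟩
      rw [max_eq_left (by linarith)] at h1
      refine ⟨?_, ?_, ?_⟩ <;> linarith
  · constructor
    · rintro ⟨h1, h2, h3⟩
      refine ⟨?_, by linarith⟩
      rw [max_eq_right (by linarith)]
      linarith
    · rintro ⟨h1, h2⟩
      rw [max_eq_right (by linarith)] at h1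
      refine ⟨?_, ?_, ?_⟩ <;> linarith

theorem layer_rows_iff (c : NodeORPCode) (s : ℕ) (X : ℕ → ℕ → ℕ → ℝ) {t u r : ℕ}
    (ht : t < sizeBound c) (hu : u < numNodes c s) (hr : r < sizeBound c) :
    (∀ k < 3, ∑ t' ∈ range (sizeBound c + 1), ∑ u' ∈ range (numNodes c s),
      ∑ j' ∈ range (sizeBound c), ((rowCoeff c s k t u r t' u' j').val : ℝ) * X t' u' j'
        ≤ ((rowRhs c s k t u r).val : ℝ)) ↔
    X (t + 1) u r = (layerAt c t).eval (numNodes c s) (shapeAdj c s) (X t) u r ∧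
      (reluAt c t = true → if phase c s t u r = true then
        0 ≤ (layerAt c t).lin (numNodes c s) (shapeAdj c s) (X t) u r + ((layerAt c t).bias r).val
        else
        (layerAt c t).lin (numNodes c s) (shapeAdj c s) (X t) u r + ((layerAt c t).bias r).val
          ≤ 0) := by
  refine Iff.trans ?_ (unit_rows_iff (reluAt c t) (phase c s t u r) (X (t + 1) u r)
    ((layerAt c t).lin (numNodes c s) (shapeAdj c s) (X t) u r) ((layerAt c t).bias r).val)
  have e0 : ∀ p : ℕ → Prop, (∀ k < 3, p k) ↔ p 0 ∧ p 1 ∧ p 2 := fun p =>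
    ⟨fun h => ⟨h 0 (by omega), h 1 (by omega), h 2 (by omega)⟩,
      fun ⟨h0, h1, h2⟩ k hk => by interval_cases k <;> assumption⟩
  rw [e0]
  have hl := sum_layerCoeff c s t u r X ht hu hr
  have hp := sum_preCoeff c s t u r X ht hu
  have hb := val_layerRhs c s t u r
  unfold active at hl hb
  rw [← hl, ← hb, ← hp]
  refine and_congr Iff.rfl (and_congr ?_ ?_)
  · simp [rowCoeff, rowRhs, Fr.val_neg, sum_neg_distrib]
  · by_cases h1 : reluAt c t = true
    · by_cases h2 : phase c s t u r = true
      · simp [rowCoeff, rowRhs, Fr.val_neg, h1, h2, sum_neg_distrib]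
      · simp [rowCoeff, rowRhs, Fr.val_neg, h1, h2]
    · simp [rowCoeff, rowRhs, h1, Fr.val_zero]

theorem realSat_iff {c : NodeORPCode} {s : ℕ} (hn : 0 < numNodes c s) (X : ℕ → ℕ → ℕ → ℝ) :
    RealSat c s X ↔
      (∀ t < sizeBound c, ∀ u < numNodes c s, ∀ r < sizeBound c,
        X (t + 1) u r = (layerAt c t).eval (numNodes c s) (shapeAdj c s) (X t) u r ∧
        (reluAt c t = true → if phase c s t u r = true then
          0 ≤ (layerAt c t).lin (numNodes c s) (shapeAdj c s) (X t) u r + ((layerAt c t).bias r).val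
          else
          (layerAt c t).lin (numNodes c s) (shapeAdj c s) (X t) u r + ((layerAt c t).bias r).val
            ≤ 0)) ∧
      (∀ u < numNodes c s, ∀ r < sizeBound c,
        IneqSat (sizeBound c) (inputIneq c s u r) (X 0 u)) ∧
      ∀ r < sizeBound c, IneqSat (sizeBound c) (outputIneq c r) (X (numLayers c) 0) := by
  have hK : 0 < sizeBound c := (Nat.zero_le _).trans_lt (numLayers_lt c)
  have h0 := fun t ht u hu r hr => layer_rows_iff c s X (t := t) (u := u) (r := r) ht hu hr
  constructor
  · intro h
    refine ⟨fun t ht u hu r hr => (h0 t ht u hu r hr).1 fun k hk => h k (by omega) t ht u hu r hr,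
      fun u hu r hr => ?_, fun r hr => ?_⟩
    -- Rows of kinds `3` and `4` do not depend on `t`, so the instance `t = 0` is representative;
    -- for kind `4` so is the node `0`, which exists by `hn`.
    · have := h 3 (by omega) 0 hK u hu r hr
      exact (sum_ineqCoeff _ (by omega) hu X).symm.trans_le this
    · have := h 4 (by omega) 0 hK 0 hn r hr
      exact (sum_ineqCoeff _ (by have := numLayers_lt c; omega) hn X).symm.trans_le this
  · rintro ⟨hlayer, hin, hout⟩ k hk t ht u hu r hr
    by_cases hk3 : k < 3
    · exact (h0 t ht u hu r hr).2 (hlayer t ht u hu r hr) k hk3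
    · obtain rfl | rfl : k = 3 ∨ k = 4 := by omega
      · exact (sum_ineqCoeff _ (by omega) hu X).trans_le (hin u hu r hr)
      · exact (sum_ineqCoeff _ (by have := numLayers_lt c; omega) hn X).trans_le (hout r hr)

end GNN

/-! ### The flattened code computes the same function as the MPNN. -/

namespace GNN

open Finset

/-! ### Evaluation of networks through their codes -/

/-- The graph on `Fin n` with a given adjacency test. -/
def finGraph {m : ℕ} (n : ℕ) (adj : ℕ → ℕ → Bool)
    (hs : ∀ u v : Fin n, adj u v = true → adj v u = true) (lab : Fin n → Fin m → ℝ) : LGraph m where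
  V := Fin n
  Adj u v := adj u.1 v.1 = true
  symm := hs
  label := lab

/-- The sequences `y u` extend the vectors `x u`. -/
def Extends {n m : ℕ} (y : ℕ → ℕ → ℝ) (x : Fin n → Fin m → ℝ) : Prop :=
  ∀ (u : Fin n) (j : Fin m), y u j = x u j

theorem getD_ofFn {α : Type*} {n : ℕ} (f : Fin n → α) (d : α) (i : Fin n) :
    (List.ofFn f).getD i d = f i := by
  rw [List.getD_eq_getElem _ _ (by simp)]
  simp

theorem val_ofCode_default : (Fr.ofCode (0, 1)).val = 0 := Fr.val_ofCode 0

theorem val_getD_vecCode {n : ℕ} (x : Fin n → ℚ) (i : Fin n) :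
    (Fr.ofCode ((vecCode x).getD i (0, 1))).val = x i := by
  rw [vecCode, getD_ofFn, Fr.val_ofCode]

theorem val_weight_code {m n : ℕ} (l : NNLayer m n) (b : Bool) (r : Fin n) (j : Fin m) :
    (FlatLayer.weight (b, l.code) r j).val = l.weight r j := by
  unfold FlatLayer.weight
  simp only [NNLayer.code]
  rw [getD_ofFn (fun i => vecCode (l.weight i)), val_getD_vecCode]

theorem val_bias_code {m n : ℕ} (l : NNLayer m n) (b : Bool) (r : Fin n) :
    (FlatLayer.bias (b, l.code) r).val = l.bias r := val_getD_vecCode l.bias r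

theorem extends_eval_false {n m p : ℕ} (l : NNLayer m p) (adj : ℕ → ℕ → Bool) {y : ℕ → ℕ → ℝ}
    {x : Fin n → Fin m → ℝ} (h : Extends y x) :
    Extends (FlatLayer.eval (false, l.code) n adj y) fun u => l.eval (x u) := by
  intro u r
  have hlin : FlatLayer.lin (false, l.code) n adj y u r = ∑ j, (l.weight r j : ℝ) * x u j := by
    change ∑ j ∈ range m, _ = _
    rw [sum_range]
    refine sum_congr rfl fun j _ => ?_
    rw [val_weight_code, h]
    simp
  unfold FlatLayer.eval
  rw [hlin, val_bias_code]
  rfl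

theorem sum_neigh_finGraph {M : Type*} [AddCommMonoid M] {n k : ℕ} (adj : ℕ → ℕ → Bool)
    (hs : ∀ u v : Fin n, adj u v = true → adj v u = true) (lab : Fin n → Fin k → ℝ) (u : Fin n)
    (f : Fin n → M) :
    ∑ w ∈ (finGraph n adj hs lab).neigh u, f w =
      ∑ w : Fin n, if adj u w = true then f w else 0 := by
  classical
  refine Eq.trans ?_ (sum_filter (fun w : Fin n => adj u w = true) f)
  refine sum_congr ?_ fun _ _ => rfl
  ext w
  exact Finset.mem_filter.trans (Finset.mem_filter (p := fun w : Fin n => adj u w = true)).symm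

/-- The input dimension `m + m` is halved by `nodeDim`, and `lin` pairs column `j` with column `m +
j`, which matches the two blocks of `Fin.append`. -/
theorem extends_eval_true {n m p k : ℕ} (l : NNLayer (m + m) p) (adj : ℕ → ℕ → Bool)
    (hs : ∀ u v : Fin n, adj u v = true → adj v u = true) (lab : Fin n → Fin k → ℝ)
    {y : ℕ → ℕ → ℝ} {x : Fin n → Fin m → ℝ} (h : Extends y x) :
    Extends (FlatLayer.eval (true, l.code) n adj y) fun u =>
      l.eval (Fin.append (x u) (∑ w ∈ (finGraph n adj hs lab).neigh u, x w)) := by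
  intro u r
  have hdim : FlatLayer.nodeDim (true, l.code) = m := by
    change (m + m) / 2 = m
    omega
  have hlin : FlatLayer.lin (true, l.code) n adj y u r = ∑ j, (l.weight r j : ℝ) *
      Fin.append (x u) (∑ w ∈ (finGraph n adj hs lab).neigh u, x w) j := by
    unfold FlatLayer.lin
    rw [hdim, sum_range, Fin.sum_univ_add, ← sum_add_distrib]
    refine sum_congr rfl fun j _ => ?_
    simp only [if_true, Fin.append_left, Fin.append_right]
    have h1 := val_weight_code l true r (Fin.castAdd m j)
    have h2 := val_weight_code l true r (Fin.natAdd m j)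
    rw [Fin.val_castAdd] at h1
    rw [Fin.val_natAdd] at h2
    rw [h1, h2, h]
    congr 2
    refine Eq.trans ?_ (congrFun (sum_neigh_finGraph adj hs lab u x).symm j)
    rw [sum_range, Finset.sum_apply]
    refine sum_congr rfl fun w _ => ?_
    rw [h w j]
    split_ifs <;> rfl
  unfold FlatLayer.eval
  rw [hlin, val_bias_code]
  rfl

noncomputable def evalLayers (n : ℕ) (adj : ℕ → ℕ → Bool) (L : List FlatLayer)
    (y : ℕ → ℕ → ℝ) : ℕ → ℕ → ℝ :=
  L.foldl (fun y l => l.eval n adj y) y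

theorem extends_evalLayers_nn {n : ℕ} (adj : ℕ → ℕ → Bool) {m p : ℕ} (N : NN m p) :
    ∀ {y : ℕ → ℕ → ℝ} {x : Fin n → Fin m → ℝ}, Extends y x →
      Extends (evalLayers n adj (N.code.map fun l => (false, l)) y) fun u => N.eval (x u) := by
  induction N with
  | single l => exact fun h => extends_eval_false l adj h
  | cons l N ih => exact fun h => ih (extends_eval_false l adj h)

theorem markHead_false (N : List LayerCode) : markHead false N = N.map fun l => (false, l) := by
  cases N <;> rfl

/-- Only the first layer depends on the mark. Its output dimension is hidden inside `N`, hence the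
hypothesis for every `p'`. -/
theorem extends_evalLayers_markHead {n : ℕ} (b : Bool) (adj : ℕ → ℕ → Bool) {q p : ℕ}
    (N : NN q p) {y : ℕ → ℕ → ℝ} {z : Fin n → Fin q → ℝ}
    (h : ∀ {p' : ℕ} (l : NNLayer q p'),
      Extends (FlatLayer.eval (b, l.code) n adj y) fun u => l.eval (z u)) :
    Extends (evalLayers n adj (markHead b N.code) y) fun u => N.eval (z u) := by
  cases N with
  | single l => exact h l
  | cons l N => exact extends_evalLayers_nn adj N (h l)

theorem extends_evalLayers_step {n m p k : ℕ} (N : NN (m + m) p) (adj : ℕ → ℕ → Bool)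
    (hs : ∀ u v : Fin n, adj u v = true → adj v u = true) (lab : Fin n → Fin k → ℝ)
    {y : ℕ → ℕ → ℝ} {x : Fin n → Fin m → ℝ} (h : Extends y x) :
    Extends (evalLayers n adj (markHead true N.code) y) ((finGraph n adj hs lab).step N x) :=
  extends_evalLayers_markHead true adj N fun l => extends_eval_true l adj hs lab h

theorem flatNet_cons (N : List LayerCode) (nets : List (List LayerCode)) :
    flatNet (N :: nets) = markHead (decide (0 < (flatNet nets).length)) N ++ flatNet nets := rfl

/-- Needed so that each combination network finds a nonempty accumulator in `flatNet` and is marked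
as aggregating. -/
theorem flatNet_code_pos {m n : ℕ} (N : MPNN m n) : 0 < (flatNet N.code).length := by
  have hnn : ∀ (b : Bool) {m n : ℕ} (N : NN m n), 0 < (markHead b N.code).length := by
    intro b m n N
    cases N <;> exact Nat.succ_pos _
  cases N with
  | readout N =>
    change 0 < (flatNet (N.code :: [])).length
    rw [flatNet_cons, List.length_append]
    exact Nat.add_pos_left (hnn _ N) _
  | layer N rest =>
    change 0 < (flatNet (N.code :: rest.code)).length
    rw [flatNet_cons, List.length_append]
    exact Nat.add_pos_left (hnn _ N) _

theorem extends_evalLayers_mpnn {n k : ℕ} (adj : ℕ → ℕ → Bool)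
    (hs : ∀ u v : Fin n, adj u v = true → adj v u = true) (lab : Fin n → Fin k → ℝ) {m p : ℕ}
    (N : MPNN m p) : ∀ {y : ℕ → ℕ → ℝ} {x : Fin n → Fin m → ℝ}, Extends y x →
      Extends (evalLayers n adj (flatNet N.code) y) (N.run (finGraph n adj hs lab) x) := by
  induction N with
  | readout N =>
    intro y x h
    have : flatNet (MPNN.readout N).code = N.code.map fun l => (false, l) := by
      change flatNet (N.code :: []) = _
      rw [flatNet_cons, ← markHead_false]
      simp [flatNet]
    rw [this]
    exact extends_evalLayers_nn adj N h
  | layer N rest ih =>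
    intro y x h
    have : flatNet (MPNN.layer N rest).code = markHead true N.code ++ flatNet rest.code := by
      change flatNet (N.code :: rest.code) = _
      rw [flatNet_cons, decide_eq_true (flatNet_code_pos rest)]
    rw [this, evalLayers, List.foldl_append]
    exact ih (extends_evalLayers_step N adj hs lab h)

/-! ### Traces -/

/-- The node vectors before each layer. -/
noncomputable def traceOf (c : NodeORPCode) (n : ℕ) (adj : ℕ → ℕ → Bool) (y : ℕ → ℕ → ℝ) :
    ℕ → ℕ → ℕ → ℝ
  | 0 => y
  | t + 1 => (layerAt c t).eval n adj (traceOf c n adj y t)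

theorem traceOf_eq_take (c : NodeORPCode) (n : ℕ) (adj : ℕ → ℕ → Bool) (y : ℕ → ℕ → ℝ) (t : ℕ)
    (ht : t ≤ numLayers c) :
    traceOf c n adj y t = evalLayers n adj ((flatNet c.2.1).take t) y := by
  induction t with
  | zero => rfl
  | succ t ih =>
    have ht' : t < (flatNet c.2.1).length := ht
    have hl : layerAt c t = (flatNet c.2.1)[t] := List.getD_eq_getElem _ _ ht'
    rw [traceOf, ih (by omega), hl, List.take_succ_eq_append_getElem ht']
    simp only [evalLayers, List.foldl_append, List.foldl_cons, List.foldl_nil]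

theorem traceOf_numLayers (c : NodeORPCode) (n : ℕ) (adj : ℕ → ℕ → Bool) (y : ℕ → ℕ → ℝ) :
    traceOf c n adj y (numLayers c) = evalLayers n adj (flatNet c.2.1) y := by
  rw [traceOf_eq_take c n adj y _ le_rfl, numLayers, List.take_length]

theorem FlatLayer.eval_congr (l : FlatLayer) {n K : ℕ} (adj : ℕ → ℕ → Bool) (hK : l.nodeDim ≤ K)
    {x x' : ℕ → ℕ → ℝ} (h : ∀ u < n, ∀ j < K, x u j = x' u j) {u : ℕ} (hu : u < n) (r : ℕ) :
    l.eval n adj x u r = l.eval n adj x' u r := by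
  have hlin : l.lin n adj x u r = l.lin n adj x' u r := by
    unfold FlatLayer.lin
    refine sum_congr rfl fun j hj => ?_
    have hj' : j < K := (mem_range.1 hj).trans_le hK
    rw [h u hu j hj']
    congr 3
    refine sum_congr rfl fun w hw => ?_
    rw [h w (mem_range.1 hw) j hj']
  unfold FlatLayer.eval
  rw [hlin]

/-- A solution is constrained only at indices within the bounds, so it agrees with the trace only
there; `FlatLayer.eval_congr` says that a layer reads nothing else. -/
theorem eq_traceOf {c : NodeORPCode} {n : ℕ} {adj : ℕ → ℕ → Bool} {X : ℕ → ℕ → ℕ → ℝ}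
    (h : ∀ t < sizeBound c, ∀ u < n, ∀ r < sizeBound c,
      X (t + 1) u r = (layerAt c t).eval n adj (X t) u r) :
    ∀ t ≤ sizeBound c, ∀ u < n, ∀ r < sizeBound c, X t u r = traceOf c n adj (X 0) t u r := by
  intro t
  induction t with
  | zero => intros; rfl
  | succ t ih =>
    intro ht u hu r hr
    rw [h t (by omega) u hu r hr, traceOf]
    exact FlatLayer.eval_congr _ adj ((nodeDim_layerAt_le c t).trans
      ((Nat.le_add_right _ _).trans (dims_layerAt_le c t))) (ih (by omega)) hu r

/-! ### Vector specifications through their codes -/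

theorem ineqSat_code_iff {m K : ℕ} (hm : m ≤ K) (q : LinIneq m) (x : ℕ → ℝ) :
    IneqSat K (vecCode q.coeff, ratCode q.bound) x ↔ q.Sat fun j => x j := by
  unfold IneqSat LinIneq.Sat
  have hsum : ∑ j ∈ range K, ((Fr.ofCode ((vecCode q.coeff).getD j (0, 1))).val : ℝ) * x j =
      ∑ j : Fin m, (q.coeff j : ℝ) * x j := by
    rw [← sum_subset (range_subset_range.2 hm) (fun j _ hj => ?_), sum_range]
    · simp only [val_getD_vecCode]
    · rw [List.getD_eq_default _ _ (by simpa [vecCode] using hj), val_ofCode_default]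
      simp
  rw [hsum, Fr.val_ofCode]

theorem ineqSat_default (K : ℕ) (x : ℕ → ℝ) : IneqSat K ([], (0, 1)) x := by
  simp [IneqSat, val_ofCode_default]

theorem forall_ineqSat_iff {m K : ℕ} (hm : m ≤ K) (ψ : VecSpec m) (hψ : ψ.length ≤ K)
    (x : ℕ → ℝ) :
    (∀ r < K, IneqSat K ((VecSpec.code ψ).getD r ([], (0, 1))) x) ↔ ψ.Sat fun j => x j := by
  have hlen : (VecSpec.code ψ).length = ψ.length := List.length_map _
  constructor
  · intro h q hq
    obtain ⟨r, hr, rfl⟩ := List.getElem_of_mem hq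
    have := h r (hr.trans_le hψ)
    rw [List.getD_eq_getElem _ _ (by omega)] at this
    simp only [VecSpec.code, List.getElem_map] at this
    exact (ineqSat_code_iff hm _ x).1 this
  · intro h r _
    by_cases hr : r < ψ.length
    · rw [List.getD_eq_getElem _ _ (by omega)]
      simp only [VecSpec.code, List.getElem_map]
      exact (ineqSat_code_iff hm _ x).2 (h _ (List.getElem_mem hr))
    · rw [List.getD_eq_default _ _ (by omega)]
      exact ineqSat_default K x

end GNN

/-! ### Locality and the small model property. -/

namespace GNN

open Finset

/-! ### Restriction to a ball -/

namespace LGraph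

variable {m : ℕ} (G : LGraph m) (v : G.V)

theorem mem_neigh {u w : G.V} : w ∈ G.neigh u ↔ G.Adj u w := by
  simp [neigh]

theorem ball_mono {i j : ℕ} (h : i ≤ j) : G.ball v i ⊆ G.ball v j := by
  induction h with
  | refl => exact subset_rfl
  | step _ ih => exact ih.trans fun u hu => Or.inl hu

theorem ball_succ_of_adj {i : ℕ} {u w : G.V} (hu : u ∈ G.ball v i) (h : G.Adj u w) :
    w ∈ G.ball v (i + 1) := Or.inr ⟨u, hu, h⟩

theorem mem_ball_self (i : ℕ) : v ∈ G.ball v i := G.ball_mono v (Nat.zero_le i) rfl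

theorem exists_atDist {i : ℕ} {u : G.V} (h : u ∈ G.ball v i) : ∃ k ≤ i, G.AtDist v u k := by
  classical
  have hex : ∃ k, u ∈ G.ball v k := ⟨i, h⟩
  exact ⟨Nat.find hex, Nat.find_min' hex h, Nat.find_spec hex, fun _ hj => Nat.find_min hex hj⟩

variable {G v}

theorem AtDist.le {u : G.V} {i k : ℕ} (h : G.AtDist v u k) (hi : u ∈ G.ball v i) : k ≤ i :=
  not_lt.1 fun hlt => h.2 i hlt hi

variable (G v)

/-- Each node of a ball contributes itself and at most `d` neighbours to the next ball. -/
theorem ncard_ball_le {d : ℕ} (hd : G.DegreeLE d) (i : ℕ) :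
    (G.ball v i).ncard ≤ (d + 1) ^ i := by
  classical
  induction i with
  | zero => simp [ball]
  | succ i ih =>
    have hsub : G.ball v (i + 1) ⊆
        ((G.ball v i).toFinite.toFinset.biUnion fun w => insert w (G.neigh w) : Finset G.V) := by
      intro u hu
      rw [Finset.mem_coe, mem_biUnion]
      rcases hu with hu | ⟨w, hw, hadj⟩
      · exact ⟨u, by simpa using hu, mem_insert_self _ _⟩
      · exact ⟨w, by simpa using hw, mem_insert_of_mem (G.mem_neigh.2 hadj)⟩
    calc (G.ball v (i + 1)).ncard ≤ _ := Set.ncard_le_ncard hsub (Finset.finite_toSet _)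
      _ = _ := Set.ncard_coe_finset _
      _ ≤ (G.ball v i).toFinite.toFinset.card * (d + 1) :=
        card_biUnion_le_card_mul _ _ _ fun w _ =>
          (card_insert_le _ _).trans (Nat.succ_le_succ (hd w))
      _ = (G.ball v i).ncard * (d + 1) := by rw [Set.ncard_eq_toFinset_card _ (Set.toFinite _)]
      _ ≤ (d + 1) ^ i * (d + 1) := Nat.mul_le_mul_right _ ih
      _ = (d + 1) ^ (i + 1) := (pow_succ _ _).symm

end LGraph

/-- The map `φ` identifies `G'` with the subgraph induced by the ball of radius `L` around `v`. -/
structure IsBallEmbedding {m m' : ℕ} (G' : LGraph m') (G : LGraph m) (v : G.V) (L : ℕ)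
    (φ : G'.V → G.V) : Prop where
  injective : Function.Injective φ
  adj_iff : ∀ a b, G'.Adj a b ↔ G.Adj (φ a) (φ b)
  mem_ball : ∀ a, φ a ∈ G.ball v L
  surj : ∀ u ∈ G.ball v L, ∃ a, φ a = u

namespace IsBallEmbedding

variable {m m' L : ℕ} {G' : LGraph m'} {G : LGraph m} {v : G.V} {φ : G'.V → G.V}

theorem map_neigh_subset (h : IsBallEmbedding G' G v L φ) (a : G'.V) :
    (G'.neigh a).map ⟨φ, h.injective⟩ ⊆ G.neigh (φ a) := by
  intro u hu
  obtain ⟨b, hb, rfl⟩ := mem_map.1 hu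
  exact G.mem_neigh.2 ((h.adj_iff a b).1 (G'.mem_neigh.1 hb))

/-- Neighbours can be lost only on the boundary of the ball; strictly inside, a node keeps its whole
neighbourhood and hence its aggregate. -/
theorem map_neigh (h : IsBallEmbedding G' G v L φ) {i : ℕ} (hi : i + 1 ≤ L) {a : G'.V}
    (ha : φ a ∈ G.ball v i) : (G'.neigh a).map ⟨φ, h.injective⟩ = G.neigh (φ a) := by
  refine subset_antisymm (h.map_neigh_subset a) fun u hu => ?_
  have hadj := G.mem_neigh.1 hu
  obtain ⟨b, rfl⟩ := h.surj u (G.ball_mono v hi (G.ball_succ_of_adj v ha hadj))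
  exact mem_map.2 ⟨b, G'.mem_neigh.2 ((h.adj_iff a b).2 hadj), rfl⟩

theorem degreeLE (h : IsBallEmbedding G' G v L φ) {d : ℕ} (hd : G.DegreeLE d) :
    G'.DegreeLE d := by
  intro a
  rw [← card_map ⟨φ, h.injective⟩]
  exact (card_le_card (h.map_neigh_subset a)).trans (hd _)

theorem mem_ball_iff (h : IsBallEmbedding G' G v L φ) {v' : G'.V} (hv : φ v' = v) :
    ∀ {i : ℕ}, i ≤ L → ∀ a, a ∈ G'.ball v' i ↔ φ a ∈ G.ball v i := by
  intro i
  induction i with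
  | zero =>
    intro _ a
    change a = v' ↔ φ a = v
    rw [← hv, h.injective.eq_iff]
  | succ i ih =>
    intro hi a
    refine or_congr (ih (by omega) a) ⟨?_, ?_⟩
    · rintro ⟨w, hw, hadj⟩
      exact ⟨φ w, (ih (by omega) w).1 hw, (h.adj_iff _ _).1 hadj⟩
    · rintro ⟨u, hu, hadj⟩
      obtain ⟨w, rfl⟩ := h.surj u (G.ball_mono v (by omega) hu)
      exact ⟨w, (ih (by omega) w).2 hu, (h.adj_iff _ _).2 hadj⟩

theorem mem_ball' (h : IsBallEmbedding G' G v L φ) {v' : G'.V} (hv : φ v' = v) (a : G'.V) :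
    a ∈ G'.ball v' L := (h.mem_ball_iff hv le_rfl a).2 (h.mem_ball a)

theorem atDist (h : IsBallEmbedding G' G v L φ) {v' : G'.V} (hv : φ v' = v) {a : G'.V} {i : ℕ}
    (ha : G'.AtDist v' a i) : G.AtDist v (φ a) i := by
  have hi : i ≤ L := ha.le (h.mem_ball' hv a)
  exact ⟨(h.mem_ball_iff hv hi a).1 ha.1, fun j hj hmem =>
    ha.2 j hj ((h.mem_ball_iff hv (by omega) a).2 hmem)⟩

/-- The output of an MPNN depends only on the ball whose radius is the number of its networks. -/
theorem run_eq (h : IsBallEmbedding G' G v L φ) {p q : ℕ} (N : MPNN p q) :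
    ∀ {x' : G'.V → Fin p → ℝ} {x : G.V → Fin p → ℝ} {i : ℕ}, i + N.code.length ≤ L →
      (∀ a, φ a ∈ G.ball v (i + N.code.length) → x' a = x (φ a)) →
      ∀ a, φ a ∈ G.ball v i → N.run G' x' a = N.run G x (φ a) := by
  induction N with
  | readout N =>
    intro x' x i _ hx a ha
    simp only [MPNN.run]
    rw [hx a (G.ball_mono v (by omega) ha)]
  | layer N rest ih =>
    intro x' x i hi hx a ha
    have hlen : (MPNN.layer N rest).code.length = rest.code.length + 1 := rfl
    rw [hlen] at hi hx
    refine ih (by omega) (fun b hb => ?_) a ha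
    simp only [LGraph.step]
    -- Each message passing layer consumes one unit of radius: the neighbours of `b` lie one step
    -- further out, where `x'` and `x` still agree.
    have hsum : ∑ w ∈ G'.neigh b, x' w = ∑ w ∈ G.neigh (φ b), x w := by
      rw [← h.map_neigh (by omega) hb, sum_map]
      refine sum_congr rfl fun w hw => hx w ?_
      exact G.ball_succ_of_adj v hb ((h.adj_iff b w).1 (G'.mem_neigh.1 hw))
    rw [hx b (G.ball_mono v (by omega) hb), hsum]

end IsBallEmbedding

/-- If a property holds, then it holds for a graph of bounded size on `Fin n` with center `0` and
bounded distances from the center. -/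
theorem NodeORP.Holds.exists_finGraph {P : NodeORP} (hP : P.Holds) :
    ∃ (n : ℕ) (hn : 0 < n) (adj : ℕ → ℕ → Bool)
      (hs : ∀ u v : Fin n, adj u v = true → adj v u = true) (lab : Fin n → Fin P.inDim → ℝ),
      n ≤ (P.input.deg + 1) ^ P.net.code.length ∧
      P.input.Sat (finGraph n adj hs lab) (⟨0, hn⟩ : Fin n) ∧
      P.output.Sat (P.net.eval (finGraph n adj hs lab) (⟨0, hn⟩ : Fin n)) ∧
      ∀ u : Fin n, u ∈ (finGraph n adj hs lab).ball (⟨0, hn⟩ : Fin n) P.net.code.length := by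
  classical
  obtain ⟨G, v, ⟨hdeg, hin⟩, hout⟩ := hP
  let L := P.net.code.length
  let n := (G.ball v L).ncard
  have hn : 0 < n := (Set.ncard_pos (Set.toFinite _)).2 ⟨v, G.mem_ball_self v L⟩
  let e₀ : Fin n ≃ G.ball v L :=
    (Finite.equivFinOfCardEq (Nat.card_coe_set_eq (G.ball v L))).symm
  -- The transposition moves the center to the index `0`, as shapes require.
  let e : Fin n ≃ G.ball v L :=
    (Equiv.swap ⟨0, hn⟩ (e₀.symm ⟨v, G.mem_ball_self v L⟩)).trans e₀
  have he : e ⟨0, hn⟩ = ⟨v, G.mem_ball_self v L⟩ := by simp [e]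
  let adj : ℕ → ℕ → Bool := fun a b =>
    decide (∃ (ha : a < n) (hb : b < n), G.Adj (e ⟨a, ha⟩) (e ⟨b, hb⟩))
  have hadj : ∀ a b : Fin n, adj a b = true ↔ G.Adj (e a) (e b) := by
    intro a b
    simp [adj]
  have hs : ∀ u v : Fin n, adj u v = true → adj v u = true := fun u w h =>
    (hadj w u).2 (G.symm _ _ ((hadj u w).1 h))
  let lab : Fin n → Fin P.inDim → ℝ := fun a => G.label (e a)
  have hφ : IsBallEmbedding (finGraph n adj hs lab) G v L fun a => (e a).1 :=
    { injective := fun a b hab => e.injective (Subtype.ext hab)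
      adj_iff := hadj
      mem_ball := fun a => (e a).2
      surj := fun u hu => ⟨e.symm ⟨u, hu⟩, by simp⟩ }
  have hv : (e ⟨0, hn⟩).1 = v := by rw [he]
  refine ⟨n, hn, adj, hs, lab, G.ncard_ball_le v hdeg L, ⟨hφ.degreeLE hdeg, fun i u hu => ?_⟩, ?_,
    hφ.mem_ball' hv⟩
  · exact hin i (e u).1 (hφ.atDist hv hu)
  · have := hφ.run_eq P.net (x' := lab) (x := G.label) (i := 0) (by omega) (fun a _ => rfl)
      (⟨0, hn⟩ : Fin n) (by rw [hv]; rfl)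
    rw [hv] at this
    unfold MPNN.eval at hout ⊢
    rw [← this] at hout
    exact hout

end GNN

/-! ### Soundness and completeness of the search through shapes. -/

namespace GNN

open Finset

/-! ### Shapes and graphs -/

theorem shapeOK_iff (c : NodeORPCode) (s : ℕ) : shapeOK c s = true ↔
    0 < numNodes c s ∧ shapeDist c s 0 = 0 ∧ ∀ u < numNodes c s,
      (∀ w < numNodes c s, shapeAdj c s u w = true →
        shapeAdj c s w u = true ∧ shapeDist c s w ≤ shapeDist c s u + 1) ∧
      (∑ w ∈ range (numNodes c s), if shapeAdj c s u w = true then 1 else 0) ≤ c.2.2.1.1 ∧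
      if shapeDist c s u = 0 then u = 0 else
        ∃ w < numNodes c s, shapeAdj c s w u = true ∧ shapeDist c s w + 1 = shapeDist c s u := by
  have hor : ∀ a b : Bool, (!a || b) = true ↔ (a = true → b = true) := by decide
  have hcond : ∀ a b d : Bool, (bif a then b else d) = true ↔
      if a = true then b = true else d = true := by decide
  have hone : ∀ b : Bool, (bif b then 1 else 0) = if b = true then 1 else 0 := by decide
  simp only [shapeOK, Bool.and_eq_true, decide_eq_true_eq, beq_iff_eq, allLT_iff, hor, sumLT_eq,
    hcond, anyLT_iff, hone, and_assoc]

theorem exists_digits (q : ℕ) (g : ℕ → ℕ) (hg : ∀ i, g i < q) (N : ℕ) :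
    ∃ s < q ^ N, ∀ i < N, s / q ^ i % q = g i := by
  have hq : 0 < q := (Nat.zero_le _).trans_lt (hg 0)
  induction N with
  | zero => exact ⟨0, by simp, by simp⟩
  | succ N ih =>
    obtain ⟨s, hs, hi⟩ := ih
    have hpos : 0 < q ^ N := pow_pos hq N
    refine ⟨s + q ^ N * g N, ?_, fun i hiN => ?_⟩
    · calc s + q ^ N * g N < q ^ N + q ^ N * g N := by omega
        _ = q ^ N * (g N + 1) := by ring
        _ ≤ q ^ N * q := Nat.mul_le_mul_left _ (hg N)
        _ = q ^ (N + 1) := (pow_succ _ _).symm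
    · rcases Nat.lt_succ_iff_lt_or_eq.1 hiN with h | rfl
      -- The new top digit adds a multiple of `q ^ (i + 1)`, which leaves digit `i` unchanged.
      · obtain ⟨k, rfl⟩ : ∃ k, N = i + (k + 1) := ⟨N - i - 1, by omega⟩
        have : q ^ (i + (k + 1)) * g (i + (k + 1)) = q ^ i * (q * (q ^ k * g (i + (k + 1)))) := by
          ring
        rw [this, Nat.add_mul_div_left _ _ (pow_pos hq i), Nat.add_mul_mod_self_left, hi i h]
      · rw [Nat.add_mul_div_left _ _ hpos, Nat.div_eq_of_lt hs, zero_add, Nat.mod_eq_of_lt (hg _)]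

/-- Every graph with distances and phases within the bounds is written by some shape. -/
theorem exists_shape (c : NodeORPCode) (n : ℕ) (adj : ℕ → ℕ → Bool) (dist : ℕ → ℕ)
    (ph : ℕ → ℕ → ℕ → Bool) (hn : n ≤ sizeBound c) (hdist : ∀ u, dist u ≤ sizeBound c) :
    ∃ s < shapeBound c, numNodes c s = n ∧
      (∀ u < n, ∀ w < n, shapeAdj c s u w = adj u w) ∧ (∀ u < n, shapeDist c s u = dist u) ∧
      ∀ t < sizeBound c, ∀ u < n, ∀ r < sizeBound c, phase c s t u r = ph t u r := by
  have hK := numLayers_lt c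
  let table : ℕ → ℕ → ℕ → ℕ → ℕ := fun a t u r =>
    if a = 0 then n else if a = 1 then (if adj t u = true then 1 else 0)
    else if a = 2 then dist t else (if ph t u r = true then 1 else 0)
  obtain ⟨s, hs, hdig⟩ := exists_digits (sizeBound c + 1)
    (fun i => table i.unpair.1 i.unpair.2.unpair.1 i.unpair.2.unpair.2.unpair.1
      i.unpair.2.unpair.2.unpair.2)
    (fun i => by
      simp only [table]
      have := hdist i.unpair.2.unpair.1
      split_ifs <;> omega)
    (index4 5 (sizeBound c + 1) (sizeBound c + 1) (sizeBound c + 1))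
  have hdig' : ∀ a < 5, ∀ t < sizeBound c + 1, ∀ u < sizeBound c + 1, ∀ r < sizeBound c + 1,
      digit c s (index4 a t u r) = table a t u r := by
    intro a ha t ht u hu r hr
    have := hdig _ (index4_lt ha ht hu hr)
    simpa [digit, index4] using this
  have hbool : ∀ b : Bool, ((if b = true then 1 else 0) == 1) = b := by decide
  refine ⟨s, hs, ?_, fun u hu w hw => ?_, fun u hu => ?_, fun t ht u hu r hr => ?_⟩
  · exact hdig' 0 (by omega) 0 (by omega) 0 (by omega) 0 (by omega)
  · rw [shapeAdj, hdig' 1 (by omega) u (by omega) w (by omega) 0 (by omega)]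
    exact hbool _
  · exact hdig' 2 (by omega) u (by omega) 0 (by omega) 0 (by omega)
  · rw [phase, hdig' 3 (by omega) t (by omega) u (by omega) r (by omega)]
    exact hbool _

theorem card_neigh_finGraph {n k : ℕ} (adj : ℕ → ℕ → Bool)
    (hs : ∀ u v : Fin n, adj u v = true → adj v u = true) (lab : Fin n → Fin k → ℝ)
    (u : Fin n) : ((finGraph n adj hs lab).neigh u).card =
      ∑ w ∈ range n, if adj u w = true then 1 else 0 := by
  rw [card_eq_sum_ones, sum_range]
  exact sum_neigh_finGraph adj hs lab u fun _ => 1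

/-- The distances of a shape are the distances of its graph. -/
theorem shapeDist_eq_of_atDist {c : NodeORPCode} {s k : ℕ} (hok : shapeOK c s = true)
    (hs : ∀ u v : Fin (numNodes c s), shapeAdj c s u v = true → shapeAdj c s v u = true)
    (lab : Fin (numNodes c s) → Fin k → ℝ) (hn : 0 < numNodes c s) {u : Fin (numNodes c s)} {i : ℕ}
    (h : (finGraph (numNodes c s) (shapeAdj c s) hs lab).AtDist
      (⟨0, hn⟩ : Fin (numNodes c s)) u i) : shapeDist c s u = i := by
  obtain ⟨-, h0, hstep⟩ := (shapeOK_iff c s).1 hok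
  let G := finGraph (numNodes c s) (shapeAdj c s) hs lab
  let v : Fin (numNodes c s) := ⟨0, hn⟩
  -- Along a path from the center the recorded distance grows by at most one per edge.
  have hle : ∀ (j : ℕ) (w : Fin (numNodes c s)), w ∈ G.ball v j → shapeDist c s w ≤ j := by
    intro j
    induction j with
    | zero =>
      rintro w (rfl : w = v)
      exact h0.le
    | succ j ih =>
      rintro w (hw | ⟨(x : Fin (numNodes c s)), hx, hadj⟩)
      · exact (ih w hw).trans (Nat.le_succ j)
      · exact (((hstep x x.2).1 w w.2 hadj).2).trans (Nat.succ_le_succ (ih x hx))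
  -- Conversely, following the closer neighbours builds a path to the center whose length is the
  -- recorded distance.
  have hmem : ∀ (j : ℕ) (w : Fin (numNodes c s)), shapeDist c s w = j → w ∈ G.ball v j := by
    intro j
    induction j with
    | zero =>
      intro w hw
      have := (hstep w w.2).2.2
      rw [if_pos hw] at this
      exact Fin.ext this
    | succ j ih =>
      intro w hw
      have := (hstep w w.2).2.2
      rw [if_neg (by omega)] at this
      obtain ⟨x, hx, hadj, hd⟩ := this
      exact Or.inr ⟨(⟨x, hx⟩ : Fin _), ih ⟨x, hx⟩ (by simp only; omega), hadj⟩
  exact le_antisymm (hle i u h.1) (not_lt.1 fun hlt => h.2 _ hlt (hmem _ u rfl))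

/-! ### Size bounds -/

section

variable (P : NodeORP)

theorem sizeBound_code : sizeBound P.code =
    (P.input.deg + 1) ^ P.net.code.length + P.net.code.length + numLayers P.code
      + ∑ t ∈ range (numLayers P.code),
          ((layerAt P.code t).2.1.1 + (layerAt P.code t).2.1.2)
      + P.inDim + P.outDim
      + ∑ i ∈ range (P.input.radius + 1),
          ((List.ofFn fun i => (P.input.constr i).code).getD i []).length
      + P.output.code.length + 1 := by
  unfold sizeBound
  rw [sumLT_eq, sumLT_eq]
  simp only [NodeORP.code, BoundSpec.code, List.length_ofFn]

theorem length_constr_le (i : Fin (P.input.radius + 1)) :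
    (P.input.constr i).length ≤ sizeBound P.code := by
  have h := single_le_sum (f := fun i =>
      ((List.ofFn fun i => (P.input.constr i).code).getD i []).length)
    (fun _ _ => Nat.zero_le _) (mem_range.2 i.2)
  rw [getD_ofFn, VecSpec.code, List.length_map] at h
  have := sizeBound_code P
  omega

theorem length_output_le : P.output.length ≤ sizeBound P.code := by
  have := sizeBound_code P
  rw [VecSpec.code, List.length_map] at this
  omega

end

/-- The input constraint of a node at distance `i`. -/
theorem forall_inputIneq_iff (P : NodeORP) (s u : ℕ) (x : ℕ → ℝ) :
    (∀ r < sizeBound P.code, IneqSat (sizeBound P.code) (inputIneq P.code s u r) x) ↔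
      ∀ i : Fin (P.input.radius + 1), shapeDist P.code s u = i →
        (P.input.constr i).Sat fun j => x j := by
  have hm : P.inDim ≤ sizeBound P.code := by
    have := sizeBound_code P
    omega
  have hq : ∀ r, inputIneq P.code s u r =
      ((List.ofFn fun i => (P.input.constr i).code).getD (shapeDist P.code s u) []).getD r
        ([], (0, 1)) := fun _ => rfl
  simp only [hq]
  by_cases h : shapeDist P.code s u < P.input.radius + 1
  · have hd := getD_ofFn (fun i => (P.input.constr i).code) [] ⟨_, h⟩
    simp only at hd
    rw [hd, forall_ineqSat_iff hm _ (length_constr_le P _)]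
    refine ⟨fun hsat i hi => ?_, fun hsat => hsat ⟨_, h⟩ rfl⟩
    have : i = ⟨_, h⟩ := Fin.ext hi.symm
    rw [this]
    exact hsat
  · refine ⟨fun _ i hi => absurd i.2 (hi ▸ h), fun _ r _ => ?_⟩
    have hnil : (List.ofFn fun i => (P.input.constr i).code).getD (shapeDist P.code s u) [] = [] :=
      List.getD_eq_default _ _ (by rw [List.length_ofFn]; omega)
    rw [hnil]
    exact ineqSat_default _ _

theorem forall_outputIneq_iff (P : NodeORP) (x : ℕ → ℝ) :
    (∀ r < sizeBound P.code, IneqSat (sizeBound P.code) (outputIneq P.code r) x) ↔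
      P.output.Sat fun j => x j := by
  have hm : P.outDim ≤ sizeBound P.code := by
    have := sizeBound_code P
    omega
  exact forall_ineqSat_iff hm P.output (length_output_le P) x

/-! ### Correctness of the decision procedure -/

/-- The labels are read off from the vectors before layer `0`. The layer rows then leave only one
possibility for the vector of node `0` after the last layer: the output of the MPNN. -/
theorem holds_of_realSat {P : NodeORP} {s : ℕ} (hok : shapeOK P.code s = true)
    {X : ℕ → ℕ → ℕ → ℝ} (hX : RealSat P.code s X) : P.Holds := by
  obtain ⟨hn, -, hshape⟩ := (shapeOK_iff _ s).1 hok
  obtain ⟨hlayer, hin, hout⟩ := (realSat_iff hn X).1 hX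
  have hs : ∀ u v : Fin (numNodes P.code s),
      shapeAdj P.code s u v = true → shapeAdj P.code s v u = true :=
    fun u v h => ((hshape u u.2).1 v v.2 h).1
  let lab : Fin (numNodes P.code s) → Fin P.inDim → ℝ := fun u j => X 0 u j
  refine ⟨finGraph _ _ hs lab, (⟨0, hn⟩ : Fin (numNodes P.code s)), ⟨fun u => ?_, fun i u hu => ?_⟩,
    ?_⟩
  · exact (card_neigh_finGraph _ hs lab u).trans_le (hshape u.1 u.2).2.1
  · exact (forall_inputIneq_iff P s u.1 (X 0 u.1)).1 (hin u.1 u.2) i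
      (shapeDist_eq_of_atDist hok hs lab hn hu)
  · have hext := extends_evalLayers_mpnn (shapeAdj P.code s) hs lab P.net (y := X 0) (x := lab)
      fun _ _ => rfl
    have hsat := (forall_outputIneq_iff P _).1 hout
    have heq : (fun j : Fin P.outDim => X (numLayers P.code) 0 j) =
        P.net.eval (finGraph _ _ hs lab) (⟨0, hn⟩ : Fin (numNodes P.code s)) := by
      funext j
      have hj : (j : ℕ) < sizeBound P.code := by
        have := sizeBound_code P
        have := j.2
        omega
      rw [eq_traceOf (fun t ht u hu r hr => (hlayer t ht u hu r hr).1) _ (numLayers_lt _).le 0 hn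
        j hj, traceOf_numLayers]
      exact hext ⟨0, hn⟩ j
    rw [heq] at hsat
    exact hsat

theorem FlatLayer.lin_congr_adj (l : FlatLayer) {n : ℕ} {adj adj' : ℕ → ℕ → Bool}
    (h : ∀ u < n, ∀ w < n, adj u w = adj' u w) (x : ℕ → ℕ → ℝ) {u : ℕ} (hu : u < n) (r : ℕ) :
    l.lin n adj x u r = l.lin n adj' x u r := by
  unfold FlatLayer.lin
  refine sum_congr rfl fun j _ => ?_
  congr 3
  refine sum_congr rfl fun w hw => ?_
  rw [h u hu w (mem_range.1 hw)]

/-- The shape consists of the small model, its true distances, and the phases given by the signs of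
the pre-activations of the actual run; the trace of that run solves the system. At pre-activation
`0` either phase would do. -/
theorem exists_realSat_of_holds {P : NodeORP} (hP : P.Holds) :
    ∃ s < shapeBound P.code, shapeOK P.code s = true ∧ ∃ X, RealSat P.code s X := by
  classical
  obtain ⟨n, hn, adj, hs, lab, hnB, ⟨hdeg, hin⟩, hout, hball⟩ := hP.exists_finGraph
  let G := finGraph n adj hs lab
  let v : Fin n := ⟨0, hn⟩
  have hbound := sizeBound_code P
  choose d hdle hd using fun u : Fin n => G.exists_atDist v (hball u)
  let dist : ℕ → ℕ := fun u => if h : u < n then d ⟨u, h⟩ else 0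
  have hdist : ∀ u : Fin n, dist u = d u := fun u => dif_pos u.2
  let y : ℕ → ℕ → ℝ := fun u j =>
    if h : u < n ∧ j < P.inDim then lab ⟨u, h.1⟩ ⟨j, h.2⟩ else 0
  have hy : Extends y lab := fun u j => dif_pos ⟨u.2, j.2⟩
  let X := traceOf P.code n adj y
  let pre : ℕ → ℕ → ℕ → ℝ := fun t u r =>
    (layerAt P.code t).lin n adj (X t) u r + ((layerAt P.code t).bias r).val
  obtain ⟨s, hsB, hsn, hsadj, hsdist, hsph⟩ := exists_shape P.code n adj dist
    (fun t u r => decide (0 ≤ pre t u r)) (by omega) (fun u => by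
      simp only [dist]
      split_ifs
      · exact (hdle _).trans (by omega)
      · exact Nat.zero_le _)
  subst hsn
  refine ⟨s, hsB, (shapeOK_iff _ s).2 ⟨hn, ?_, fun u hu => ⟨fun w hw hadj => ?_, ?_, ?_⟩⟩, X,
    (realSat_iff hn X).2 ⟨fun t ht u hu r hr => ⟨?_, fun _ => ?_⟩, fun u hu => ?_, ?_⟩⟩
  · rw [hsdist 0 hn, hdist v]
    exact Nat.le_zero.1 ((hd v).le (G.mem_ball_self v 0))
  · rw [hsadj u hu w hw] at hadj
    refine ⟨(hsadj w hw u hu).trans (hs ⟨u, hu⟩ ⟨w, hw⟩ hadj), ?_⟩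
    rw [hsdist u hu, hsdist w hw, hdist ⟨u, hu⟩, hdist ⟨w, hw⟩]
    exact (hd ⟨w, hw⟩).le (G.ball_succ_of_adj v (w := (⟨w, hw⟩ : Fin _)) (hd ⟨u, hu⟩).1 hadj)
  · refine le_trans (le_of_eq ?_) (hdeg (⟨u, hu⟩ : Fin _))
    rw [card_neigh_finGraph]
    exact sum_congr rfl fun w hw => by rw [hsadj u hu w (mem_range.1 hw)]
  · rw [hsdist u hu, hdist ⟨u, hu⟩]
    have hdu := hd ⟨u, hu⟩
    split_ifs with h0
    · rw [h0] at hdu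
      exact congrArg Fin.val (show (⟨u, hu⟩ : Fin _) = v from hdu.1)
    -- The last step of a shortest path supplies the closer neighbour; its distance is exactly `i`,
    -- since otherwise `u` would be nearer to the center.
    · obtain ⟨i, hi⟩ := Nat.exists_eq_succ_of_ne_zero h0
      rw [hi] at hdu ⊢
      obtain hmem | ⟨w, hw, hadj⟩ := hdu.1
      · exact absurd hmem (hdu.2 i (Nat.lt_succ_self i))
      · refine ⟨w.1, w.2, (hsadj w.1 w.2 u hu).trans hadj, ?_⟩
        rw [hsdist w.1 w.2, hdist w]
        refine congrArg (· + 1) (le_antisymm ((hd w).le hw) ?_)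
        have := hdu.le (G.ball_succ_of_adj v (hd w).1 hadj)
        omega
  · change (layerAt P.code t).eval _ adj (X t) u r = _
    unfold FlatLayer.eval
    rw [FlatLayer.lin_congr_adj _ hsadj _ hu]
  · rw [hsph t ht u hu r hr, FlatLayer.lin_congr_adj _ hsadj _ hu]
    by_cases h : 0 ≤ pre t u r
    · rw [if_pos (decide_eq_true h)]
      exact h
    · rw [if_neg (by simpa using h)]
      exact (not_le.1 h).le
  · refine (forall_inputIneq_iff P s u (X 0 u)).2 fun i hi => ?_
    rw [hsdist u hu, hdist ⟨u, hu⟩] at hi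
    have hsat := hin i (⟨u, hu⟩ : Fin _) (hi ▸ hd ⟨u, hu⟩)
    have heq : (fun j : Fin P.inDim => X 0 u j) = lab ⟨u, hu⟩ := funext fun j => hy ⟨u, hu⟩ j
    rw [heq]
    exact hsat
  · refine (forall_outputIneq_iff P _).2 ?_
    have hext := extends_evalLayers_mpnn adj hs lab P.net hy
    have heq : (fun j : Fin P.outDim => X (numLayers P.code) 0 j) = P.net.eval G v := by
      funext j
      simp only [X]
      rw [traceOf_numLayers]
      exact hext v j
    rw [heq]
    exact hout

theorem decision_code_iff (P : NodeORP) : decision P.code = true ↔ P.Holds := by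
  simp only [decision, anyLT_iff, Bool.and_eq_true, feasible_iff]
  constructor
  · rintro ⟨s, -, hok, X, hX⟩
    exact holds_of_realSat hok hX
  · exact exists_realSat_of_holds

end GNN

theorem theorem2 : GNN.FormallyVerifiable GNN.NodeORP.code GNN.NodeORP.Holds := by
  exact ⟨GNN.decision, GNN.computable_decision, GNN.decision_code_iff⟩
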